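/- Let $N\ge 1$ and $m$ be integers and let $k>2$ be either an even integer, or half an odd integer in which case $4\mid N$. Write $e(w)=e^{2\pi i w}$, $z=x+iy$ with $y>0$, $q=e(z)$. For $\gamma=\begin{pmatrix}a&b\\c&d\end{pmatrix}\in\Gamma_0(N)$ put $j(\gamma,z)=\sqrt{cz+d}$ if $k\in\mathbb Z$ and $j(\gamma,z)=\left(\frac cd\right)\varepsilon_d^{-1}\sqrt{cz+d}$ otherwise, with the principal root, $\varepsilon_d=1$ or $i$ according as $d\equiv 1$ or $3\pmod 4$, and $\left(\frac cd\right)$ the Jacobi symbol $\left(\frac{c}{|d|}\right)$, with its sign changed if $c,d<0$; let $(f|_k\gamma)(z)=j(\gamma,z)^{-2k}f(\gamma z)$. For $s\in\mathbb C$ let $\varphi_{m,k}(z,s)=\mathcal M_{m,k}(y,s)e(mx)$, where $$\mathcal M_{m,k}(y,s)=\Gamma(2s)^{-1}(4\pi|m|y)^{-k/2}M_{\frac k2\mathrm{sgn}(m),\,s-\frac12}(4\pi|m|y)\ (m\ne0),\qquad \mathcal M_{0,k}(y,s)=y^{s-k/2},$$ and $M_{\mu,\nu}$ is the Whittaker function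 $M_{\mu,\nu}(y)=e^{-y/2}y^{\nu+1/2}\sum_{n\ge0}\frac{(\nu-\mu+\frac12)_n}{(1+2\nu)_n}\frac{y^n}{n!}$, with $(a)_n=a(a+1)\cdots(a+n-1)$. With $\Gamma_\infty=\{\pm\begin{pmatrix}1&n\\0&1\end{pmatrix}:n\in\mathbb Z\}$ define the Poincaré series $$F_{m,k,N}(z,s)=\sum_{\gamma\in\Gamma_\infty\backslash\Gamma_0(N)}(\varphi_{m,k}(\cdot,s)|_k\gamma)(z).$$ For a positive integer $c$ let $K_k(m,n,c)=\sum_{v}\chi(v)\,e\!\left(\frac{m\bar v+nv}{c}\right)$, over the residues $v$ modulo $c$ prime to $c$, where $v\bar v\equiv1\pmod c$, and $\chi(v)=1$ if $k\in\mathbb Z$, $\chi(v)=\left(\frac cv\right)^{2k}\varepsilon_v^{2k}$ otherwise. For $n>0$ put $$c_{m,k}(n,s)=2\pi i^{-k}\sum_{c>0}\frac{K_k(m,n,Nc)}{Nc}\times\begin{cases}|mn|^{\frac{1-k}2}J_{2s-1}\!\left(\frac{4\pi\sqrt{|mn|}}{Nc}\right),&m>0,\\ |mn|^{\frac{1-k}2}I_{2s-1}\!\left(\frac{4\pi\sqrt{|mn|}}{Nc}\right),&m<0,\\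 2^{k-1}\pi^{s+\frac k2-1}n^{s-\frac k2}(Nc)^{1-2s},&m=0,\end{cases}$$ with the usual Bessel functions $J$, $I$ and $i^{-k}=e^{-\pi i k/2}$. Then, at $s=k/2$, the Poincaré series and the series for $c_{m,k}(n,k/2)$ $(n>0)$ converge absolutely, and for all $z$ in the upper half plane $$F_{m,k,N}(z,k/2)=\frac{\delta_m}{\Gamma(k)}q^m+\sum_{n>0}\frac{c_{m,k}(n,k/2)}{\Gamma(k)}\,n^{k-1}q^n,$$ where $\delta_m=\Gamma(k)$ if $m=0$ and $\delta_m=1$ otherwise. Moreover, as a function of $z$, $F_{m,k,N}(z,k/2)$ is a cusp form of weight $k$ for $\Gamma_0(N)$ (with respect to $|_k$) if $m>0$, a weakly holomorphic modular form (holomorphic on the upper half plane, at most exponential growth at the cusps) if $m<0$, and a holomorphic modular form if $m=0$. -/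

import Mathlib

open UpperHalfPlane
open scoped MatrixGroups Manifold

noncomputable section

namespace MaassPoincare

/-! Weights are `k = κ / 2` with `κ : ℤ` (so `k` is integral iff `κ` is even). -/

/-- The weight `k = κ / 2` as a real number. -/
def wt (κ : ℤ) : ℝ := (κ : ℝ) / 2

/-- `e(w) = exp(2 π i w)`. -/
def e (w : ℂ) : ℂ := Complex.exp (2 * Real.pi * Complex.I * w)

/-! ### Whittaker and Bessel functions -/

/-- Kummer's confluent hypergeometric function
`M(a, b, x) = ∑ (a)_n / (b)_n * x ^ n / n!`. -/
def kummerM (a b x : ℂ) : ℂ :=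
  ∑' n : ℕ, (ascPochhammer ℂ n).eval a / (ascPochhammer ℂ n).eval b * (x ^ n / (n.factorial : ℂ))

/-- The Whittaker function
`M_{μ,ν}(y) = e^{-y/2} y^{ν+1/2} M(ν - μ + 1/2, 1 + 2ν, y)` for `y > 0`. -/
def whittakerM (μ ν : ℂ) (y : ℝ) : ℂ :=
  Complex.exp (-(y : ℂ) / 2) * (y : ℂ) ^ (ν + 1 / 2) * kummerM (ν - μ + 1 / 2) (1 + 2 * ν) y

/-- The Bessel function `J_α(x)` for `x > 0`. -/
def besselJ (α : ℂ) (x : ℝ) : ℂ :=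
  ∑' j : ℕ, (-1 : ℂ) ^ j / ((j.factorial : ℂ) * Complex.Gamma (α + j + 1)) *
    ((x / 2 : ℝ) : ℂ) ^ (α + 2 * j)

/-- The modified Bessel function `I_α(x)` for `x > 0`. -/
def besselI (α : ℂ) (x : ℝ) : ℂ :=
  ∑' j : ℕ, 1 / ((j.factorial : ℂ) * Complex.Gamma (α + j + 1)) *
    ((x / 2 : ℝ) : ℂ) ^ (α + 2 * j)

/-- `ℳ_{n,k}(y, s)`, for `y > 0`. -/
def calM (κ n : ℤ) (y : ℝ) (s : ℂ) : ℂ :=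
  if n = 0 then (y : ℂ) ^ (s - (wt κ : ℂ) / 2)
  else (Complex.Gamma (2 * s))⁻¹ *
    ((4 * Real.pi * |(n : ℝ)| * y : ℝ) : ℂ) ^ (-((wt κ : ℂ) / 2)) *
    whittakerM ((wt κ : ℂ) / 2 * (n.sign : ℂ)) (s - 1 / 2) (4 * Real.pi * |(n : ℝ)| * y)

/-- `φ_{m,k}(z, s) = ℳ_{m,k}(y, s) e(m x)`, where `z = x + i y`. -/
def phi (κ m : ℤ) (s : ℂ) (z : ℍ) : ℂ := calM κ m z.im s * e ((m : ℂ) * (z.re : ℂ))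

/-! ### The automorphy factor and the slash operator -/

/-- The extended quadratic residue symbol `(c/d)` for odd `d`: the Jacobi symbol `(c/|d|)`, with
its sign changed when both `c` and `d` are negative; in particular `(0/±1) = 1`. -/
def quadSymbol (c d : ℤ) : ℤ :=
  (if c < 0 ∧ d < 0 then -1 else 1) * jacobiSym c d.natAbs

/-- `ε_d` for odd `d`: `1` if `d ≡ 1 (mod 4)` and `i` if `d ≡ 3 (mod 4)`. -/
def eps (d : ℤ) : ℂ := if d % 4 = 1 then 1 else Complex.I

/-- `c z + d`, where `(c, d)` is the bottom row of `γ`. -/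
def cocycle (γ : SL(2, ℤ)) (z : ℍ) : ℂ := ((γ 1 0 : ℤ) : ℂ) * (z : ℂ) + ((γ 1 1 : ℤ) : ℂ)

/-- The automorphy factor `j(γ, z)`: the principal root `√(c z + d)` when `k = κ/2` is an integer,
and `(c/d) ε_d⁻¹ √(c z + d)` otherwise. -/
def jFactor (κ : ℤ) (γ : SL(2, ℤ)) (z : ℍ) : ℂ :=
  if Even κ then cocycle γ z ^ (1 / 2 : ℂ)
  else (quadSymbol (γ 1 0) (γ 1 1) : ℂ) * (eps (γ 1 1))⁻¹ * cocycle γ z ^ (1 / 2 : ℂ)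

/-- The slash operator `(f|_k γ)(z) = j(γ, z)^{-2k} f(γ z)`, for `γ ∈ Γ₀(N)`; here `2k = κ`. -/
def slash (κ : ℤ) (f : ℍ → ℂ) (γ : SL(2, ℤ)) (z : ℍ) : ℂ := jFactor κ γ z ^ (-κ) * f (γ • z)

/-- The subgroup `Γ_∞` of all `± [1, n; 0, 1]` in `Γ₀(N)`. -/
def GammaInf (N : ℕ) : Subgroup (CongruenceSubgroup.Gamma0 N) where
  carrier := {γ | ∃ n : ℤ, (γ : SL(2, ℤ)) = ModularGroup.T ^ n ∨
    (γ : SL(2, ℤ)) = -ModularGroup.T ^ n}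
  one_mem' := ⟨0, by simp⟩
  mul_mem' := by
    rintro a b ⟨n, hn⟩ ⟨l, hl⟩
    refine ⟨n + l, ?_⟩
    rcases hn with hn | hn <;> rcases hl with hl | hl <;> simp [hn, hl, zpow_add]
  inv_mem' := by
    rintro a ⟨n, hn⟩
    refine ⟨-n, ?_⟩
    rcases hn with hn | hn
    · left; simp [hn]
    · right
      rw [Subgroup.coe_inv, hn, zpow_neg]
      exact inv_eq_of_mul_eq_one_right (by simp)

/-- The coset space `Γ_∞ \ Γ₀(N)`. -/
abbrev Cosets (N : ℕ) : Type := Quotient (QuotientGroup.rightRel (GammaInf N))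

/-- The summand `(φ_{m,k}|_k γ)(z)` of the Poincaré series at the coset `Γ_∞ γ`. It is evaluated
at some representative; `poincareTerm_mk` below shows that the representative is immaterial. -/
def poincareTerm (κ m : ℤ) (N : ℕ) (s : ℂ) (z : ℍ) (γ : Cosets N) : ℂ :=
  slash κ (phi κ m s) (γ.out : CongruenceSubgroup.Gamma0 N) z

/-- The Poincaré series
`F_{m,k,N}(z, s) = ∑_{γ ∈ Γ_∞ \ Γ₀(N)} (φ_{m,k}(·, s)|_k γ)(z)`. -/
def poincare (κ m : ℤ) (N : ℕ) (s : ℂ) (z : ℍ) : ℂ := ∑' γ : Cosets N, poincareTerm κ m N s z γ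

/-! ### Kloosterman sums and the coefficients -/

/-- The (generalized) Kloosterman sum `K_k(m, n, c)`, a sum over the residues `v` modulo `c` which
are prime to `c`, with `v v̄ ≡ 1 (mod c)`. -/
def kloosterman (κ m n : ℤ) (c : ℕ) : ℂ :=
  ∑ v ∈ (Finset.range c).filter (fun v => Nat.Coprime v c),
    (if Even κ then 1 else (quadSymbol (c : ℤ) (v : ℤ) : ℂ) ^ κ * eps (v : ℤ) ^ κ) *
      e (((m : ℂ) * ((((v : ZMod c)⁻¹).val : ℕ) : ℂ) + (n : ℂ) * (v : ℂ)) / (c : ℂ))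

/-- The factor of the Kloosterman sum in the series for `c_{m,k}(n, s)`, at the modulus `M`. -/
def coeffKernel (κ m n : ℤ) (s : ℂ) (M : ℕ) : ℂ :=
  if 0 < m * n then
    ((|(m * n : ℝ)| ^ ((1 - wt κ) / 2) : ℝ) : ℂ) *
      besselJ (2 * s - 1) (4 * Real.pi * √|(m * n : ℝ)| / M)
  else if m * n < 0 then
    ((|(m * n : ℝ)| ^ ((1 - wt κ) / 2) : ℝ) : ℂ) *
      besselI (2 * s - 1) (4 * Real.pi * √|(m * n : ℝ)| / M)
  else if m + n ≠ 0 then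
    (2 : ℂ) ^ ((wt κ : ℂ) - 1) * (Real.pi : ℂ) ^ (s + (wt κ : ℂ) / 2 - 1) *
      ((|(m + n : ℝ)| : ℝ) : ℂ) ^ (s - (wt κ : ℂ) / 2) * (M : ℂ) ^ (1 - 2 * s)
  else
    (2 : ℂ) ^ (2 * (wt κ : ℂ) - 2) * (Real.pi : ℂ) ^ ((wt κ : ℂ) - 1) * Complex.Gamma (2 * s) *
      (2 * (M : ℂ)) ^ (1 - 2 * s)

/-- The term of the series for `c_{m,k}(n, s)` that belongs to `c > 0`. -/
def coeffTerm (κ m : ℤ) (N : ℕ) (n : ℤ) (s : ℂ) (c : ℕ+) : ℂ :=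
  kloosterman κ m n (N * (c : ℕ)) / ((N * (c : ℕ) : ℕ) : ℂ) * coeffKernel κ m n s (N * (c : ℕ))

/-- The coefficient `c_{m,k}(n, s)` (which also depends on `N`). -/
def coeff (κ m : ℤ) (N : ℕ) (n : ℤ) (s : ℂ) : ℂ :=
  2 * Real.pi * Complex.I ^ (-(wt κ : ℂ)) * ∑' c : ℕ+, coeffTerm κ m N n s c

/-- `δ_m = Γ(k)` if `m = 0` and `δ_m = 1` otherwise. -/
def delta (κ m : ℤ) : ℂ := if m = 0 then Complex.Gamma (wt κ) else 1

/-! ### Spaces of modular forms of weight `k = κ/2` on `Γ₀(N)` -/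

/-- `(c z + d)^{-k} f(A z)` for `A ∈ SL₂(ℤ)`, with the principal branch: the behaviour of `f` at
the cusp `A ∞`. -/
def atCusp (κ : ℤ) (f : ℍ → ℂ) (A : SL(2, ℤ)) (z : ℍ) : ℂ :=
  cocycle A z ^ (-(wt κ : ℂ)) * f (A • z)

/-- `f ∈ M^!_k(N)`: `f` is holomorphic on the upper half plane, invariant under the weight `k`
action of `Γ₀(N)`, and of at most exponential growth (that is, meromorphic) at every cusp. -/
structure IsWeaklyHolomorphicForm (κ : ℤ) (N : ℕ) (f : ℍ → ℂ) : Prop where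
  holo : MDiff f
  slash_eq : ∀ γ ∈ CongruenceSubgroup.Gamma0 N, ∀ z : ℍ, slash κ f γ z = f z
  growth : ∀ A : SL(2, ℤ), ∃ C : ℝ,
    atCusp κ f A =O[atImInfty] (fun z : ℍ => Real.exp (C * z.im))

/-- `f ∈ M_k(N)`: `f` is holomorphic on the upper half plane and at every cusp, and invariant. -/
structure IsHolomorphicForm (κ : ℤ) (N : ℕ) (f : ℍ → ℂ) : Prop where
  holo : MDiff f
  slash_eq : ∀ γ ∈ CongruenceSubgroup.Gamma0 N, ∀ z : ℍ, slash κ f γ z = f z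
  bounded : ∀ A : SL(2, ℤ), IsBoundedAtImInfty (atCusp κ f A)

/-- `f ∈ S_k(N)`: `f` is holomorphic on the upper half plane, invariant, and zero at every cusp. -/
structure IsCuspidalForm (κ : ℤ) (N : ℕ) (f : ℍ → ℂ) : Prop where
  holo : MDiff f
  slash_eq : ∀ γ ∈ CongruenceSubgroup.Gamma0 N, ∀ z : ℍ, slash κ f γ z = f z
  zero : ∀ A : SL(2, ℤ), IsZeroAtImInfty (atCusp κ f A)

/-! ### The summands of the Poincaré series do not depend on the representatives -/

lemma phi_vadd (κ m : ℤ) (s : ℂ) (n : ℤ) (z : ℍ) : phi κ m s ((n : ℝ) +ᵥ z) = phi κ m s z := by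
  have h : e ((m : ℂ) * (((n : ℝ) + z.re : ℝ) : ℂ)) = e ((m : ℂ) * (z.re : ℂ)) := by
    unfold e
    rw [Complex.exp_eq_exp_iff_exists_int]
    exact ⟨m * n, by push_cast; ring⟩
  simp only [phi, UpperHalfPlane.vadd_im, UpperHalfPlane.vadd_re, h]

lemma neg_cpow_half (w : ℂ) (hw : 0 < w.im) :
    (-w) ^ (1 / 2 : ℂ) = -Complex.I * w ^ (1 / 2 : ℂ) := by
  have h0 : w ≠ 0 := by rintro rfl; simp at hw
  have hlog : Complex.log (-w) = Complex.log w - Real.pi * Complex.I := by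
    apply Complex.ext
    · simp [Complex.log_re]
    · simp [Complex.log_im, Complex.arg_neg_eq_arg_sub_pi_of_im_pos hw]
  rw [Complex.cpow_def_of_ne_zero (neg_ne_zero.mpr h0), Complex.cpow_def_of_ne_zero h0, hlog,
    sub_mul, Complex.exp_sub]
  have : Complex.exp (↑Real.pi * Complex.I * (1 / 2)) = Complex.I := by
    convert Complex.exp_pi_div_two_mul_I using 2; ring
  rw [this, Complex.div_I]; ring

lemma cocycle_neg (γ : SL(2, ℤ)) (z : ℍ) : cocycle (-γ) z = -cocycle γ z := by
  simp [cocycle]; ring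

lemma odd_of_mem_Gamma0 {N : ℕ} (hN : 4 ∣ N) {γ : SL(2, ℤ)}
    (hγ : γ ∈ CongruenceSubgroup.Gamma0 N) : γ 1 1 % 2 = 1 := by
  have h : (N : ℤ) ∣ γ 1 0 := by
    rw [CongruenceSubgroup.Gamma0_mem] at hγ
    exact (ZMod.intCast_zmod_eq_zero_iff_dvd _ _).mp hγ
  have h4 : (2 : ℤ) ∣ γ 1 0 := by
    refine (Dvd.dvd.trans ?_ h)
    exact_mod_cast (show 2 ∣ N by omega)
  have hdet := Matrix.det_fin_two γ.1
  rw [γ.2] at hdet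
  rcases Int.even_or_odd (γ 1 1) with h2 | h2
  · exfalso
    obtain ⟨a, ha⟩ := h4
    obtain ⟨b, hb⟩ := h2
    rw [ha, hb] at hdet
    have : (2 : ℤ) ∣ 1 := ⟨γ 0 0 * b - γ 0 1 * a, by linarith⟩
    omega
  · exact Int.odd_iff.mp h2

lemma jFactor_neg_of_pos {κ : ℤ} (hκ : Odd κ) (γ : SL(2, ℤ)) (hc : 0 < γ 1 0)
    (hd : γ 1 1 % 2 = 1) (z : ℍ) : jFactor κ (-γ) z = jFactor κ γ z := by
  have hev : ¬ Even κ := by simpa using hκ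
  have him : 0 < (cocycle γ z).im := by
    simpa [cocycle] using mul_pos (Int.cast_pos.mpr hc : (0 : ℝ) < (γ 1 0 : ℤ)) z.im_pos
  have hodd : Odd (γ 1 1).natAbs := by rw [Int.natAbs_odd, Int.odd_iff]; exact hd
  simp only [jFactor, hev, if_false, cocycle_neg, neg_cpow_half _ him]
  set c := γ 1 0
  set d := γ 1 1
  have e1 : (-γ) 1 0 = -c := rfl
  have e2 : (-γ) 1 1 = -d := rfl
  rw [e1, e2]
  have q1 : quadSymbol c d = jacobiSym c d.natAbs := by simp [quadSymbol, hc.le]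
  have q2 : quadSymbol (-c) (-d)
      = (if 0 < d then -1 else 1) * (ZMod.χ₄ d.natAbs * jacobiSym c d.natAbs) := by
    rw [quadSymbol, Int.natAbs_neg, jacobiSym.neg _ hodd]; simp [hc]
  rw [q1, q2]
  rcases (by omega : (d % 4 = 1) ∨ (d % 4 = 3)) with h | h <;>
    rcases lt_or_ge 0 d with hp | hp
  · have hχ := ZMod.χ₄_nat_one_mod_four (show d.natAbs % 4 = 1 by omega)
    rw [hχ]
    simp [eps, h, show (-d) % 4 ≠ 1 by omega, hp]
    ring_nf; simp
  · have hχ := ZMod.χ₄_nat_three_mod_four (show d.natAbs % 4 = 3 by omega)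
    rw [hχ]
    simp [eps, h, show (-d) % 4 ≠ 1 by omega, hp.not_gt]
    ring_nf; simp
  · have hχ := ZMod.χ₄_nat_three_mod_four (show d.natAbs % 4 = 3 by omega)
    rw [hχ]
    simp [eps, h, show (-d) % 4 = 1 by omega, hp]
    ring
  · have hχ := ZMod.χ₄_nat_one_mod_four (show d.natAbs % 4 = 1 by omega)
    rw [hχ]
    simp [eps, h, show (-d) % 4 = 1 by omega, hp.not_gt]
    ring

lemma jFactor_one_neg_one {κ : ℤ} (hκ : Odd κ) (γ γ' : SL(2, ℤ)) (hc : γ 1 0 = 0)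
    (hd : γ 1 1 = 1) (hc' : γ' 1 0 = 0) (hd' : γ' 1 1 = -1) (z : ℍ) :
    jFactor κ γ' z = jFactor κ γ z := by
  have hev : ¬ Even κ := by simpa using hκ
  have hI : (-1 : ℂ) ^ (2⁻¹ : ℂ) = Complex.I := by
    rw [Complex.cpow_def_of_ne_zero (by norm_num), Complex.log_neg_one]
    convert Complex.exp_pi_div_two_mul_I using 2; ring
  simp [jFactor, hev, cocycle, hc, hd, hc', hd', quadSymbol, eps, hI]

lemma jFactor_neg (κ : ℤ) (N : ℕ) (hκ : 4 ∣ κ ∨ (Odd κ ∧ 4 ∣ N)) (γ : SL(2, ℤ))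
    (hγ : γ ∈ CongruenceSubgroup.Gamma0 N) (z : ℍ) :
    jFactor κ (-γ) z ^ (-κ) = jFactor κ γ z ^ (-κ) := by
  rcases hκ with ⟨l, rfl⟩ | ⟨hodd, hN⟩
  · have hev : Even (4 * l) := ⟨2 * l, by ring⟩
    have key : ∀ w : ℂ, (w ^ (1 / 2 : ℂ)) ^ (-(4 * l)) = (w ^ 2) ^ (-l) := by
      intro w
      have h2 : (w ^ (1 / 2 : ℂ)) ^ 2 = w := by
        simp
      rw [show -(4 * l) = ((4 : ℕ) : ℤ) * (-l) by push_cast; ring, zpow_mul, zpow_natCast,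
        show (4 : ℕ) = 2 * 2 from rfl, pow_mul, h2]
    simp only [jFactor, hev, if_true, key, cocycle_neg]
    congr 1; ring
  · congr 1
    have hd := odd_of_mem_Gamma0 hN hγ
    rcases lt_trichotomy (γ 1 0) 0 with h | h | h
    · have := jFactor_neg_of_pos hodd (-γ) (by simpa using h)
        (by change (-(γ 1 1)) % 2 = 1; omega) z
      rw [neg_neg] at this
      exact this.symm
    · have hdet := Matrix.det_fin_two γ.1
      rw [γ.2, h, mul_zero, sub_zero] at hdet
      rcases Int.isUnit_iff.mp (IsUnit.of_mul_eq_one_right _ hdet.symm) with h1 | h1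
      · exact jFactor_one_neg_one hodd γ (-γ) h h1 (by simp [h]) (by simp [h1]) z
      · exact (jFactor_one_neg_one hodd (-γ) γ (by simp [h]) (by simp [h1]) h h1 z).symm
    · exact jFactor_neg_of_pos hodd γ h hd z

lemma slash_phi_T (κ m : ℤ) (s : ℂ) (n : ℤ) (γ : SL(2, ℤ)) (z : ℍ) :
    slash κ (phi κ m s) (ModularGroup.T ^ n * γ) z = slash κ (phi κ m s) γ z := by
  have h0 : (ModularGroup.T ^ n * γ) 1 0 = γ 1 0 := by
    simp
  have h1 : (ModularGroup.T ^ n * γ) 1 1 = γ 1 1 := by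
    simp
  simp only [slash, jFactor, cocycle, h0, h1, mul_smul, UpperHalfPlane.modular_T_zpow_smul,
    phi_vadd]

/-- The summands of the Poincaré series are functions of the coset `Γ_∞ γ` only. -/
lemma slash_phi_eq_of_rel (κ m : ℤ) (N : ℕ) (hκ : 4 ∣ κ ∨ (Odd κ ∧ 4 ∣ N)) (s : ℂ) (z : ℍ)
    (γ γ' : CongruenceSubgroup.Gamma0 N) (h : γ' * γ⁻¹ ∈ GammaInf N) :
    slash κ (phi κ m s) (γ' : SL(2, ℤ)) z = slash κ (phi κ m s) (γ : SL(2, ℤ)) z := by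
  obtain ⟨n, hn | hn⟩ := h
  · have : (γ' : SL(2, ℤ)) = ModularGroup.T ^ n * γ := by rw [← hn]; simp
    rw [this, slash_phi_T]
  · have : (γ' : SL(2, ℤ)) = -(ModularGroup.T ^ n * γ) := by rw [← neg_mul, ← hn]; simp
    have hm : -(γ' : SL(2, ℤ)) = ModularGroup.T ^ n * γ := by rw [this, neg_neg]
    rw [← slash_phi_T κ m s n γ, ← hm]
    simp only [slash, ModularGroup.SL_neg_smul, jFactor_neg κ N hκ _ γ'.2]

lemma poincareTerm_mk (κ m : ℤ) (N : ℕ) (hκ : 4 ∣ κ ∨ (Odd κ ∧ 4 ∣ N)) (s : ℂ) (z : ℍ)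
    (γ : CongruenceSubgroup.Gamma0 N) :
    poincareTerm κ m N s z (Quotient.mk (QuotientGroup.rightRel (GammaInf N)) γ) =
      slash κ (phi κ m s) (γ : SL(2, ℤ)) z :=
  slash_phi_eq_of_rel κ m N hκ s z γ _ (QuotientGroup.rightRel_apply.mp
    ((QuotientGroup.rightRel (GammaInf N)).symm
      (Quotient.mk_out (s := QuotientGroup.rightRel (GammaInf N)) γ)))

end MaassPoincare

end

noncomputable section

namespace MaassPoincare

section

/-! ### The seed of the Poincaré series -/

/-! At `s = k/2` the Whittaker function degenerates. Its Kummer series has first parameter `0` or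
equal to the second, so it is `1` or an exponential, and the seed is a constant times `q^m` whatever
the sign of `m` (`phi_half_weight`). The Poincaré series becomes the classical sum of multiplier
times `(cz+d)^(-k) e(m γz)`, and `k > 2` makes it tractable.

Convergence and cusps. For fixed `z` the heights `Im γz` are bounded, so the terms are dominated by
the lattice sum of `|cz+d|^(-k)`. At a cusp `A∞` the same works with the bottom rows of `γA`: rows
with `c = 0` contribute at most a multiple of `e^(-2πmy)`, all others a decaying power of `y`
(`exists_atCusp_bound`). This distinguishes the three cases of `m`.

Invariance is a reindexing of cosets, once `j^(-2k)` is a cocycle (`jFactor_zpow_mul`). For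
half-integral `k` this is checked, without theta functions, on the generators `T`, `[1, 0; 4, 1]`
and `-1` of `Γ₀(4)` (`jFactor_mul`).

Fourier expansion. The nontrivial cosets correspond to triples `(c, v, n)`. With `M = Nc` and `w = z
+ v/M`, the term is a factor independent of `n` times `(w+n)^(-k) e(-(m/M²)/(w+n))`. Expanding the
exponential and applying Lipschitz's formula (Poisson summation) with exponents `k + j` sums over
`n` and yields the power series `∑ x^j / (j! Γ(k+j))` (`hasSum_besselSeries_mul_e`). That one series
is `J` for `m > 0`, `I` for `m < 0` and its value at `0` for `m = 0` (`coeffKernel_div`). Summing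
over `v` produces the Kloosterman sums, and their trivial bound justifies interchanging `c` and `n`.
Holomorphy is read off the resulting `q`-series. -/

lemma e_add (v w : ℂ) : e (v + w) = e v * e w := by
  simp only [e, mul_add, Complex.exp_add]

lemma e_int (n : ℤ) : e n = 1 := by
  rw [e, mul_comm]
  exact Complex.exp_int_mul_two_pi_mul_I n

lemma norm_e (w : ℂ) : ‖e w‖ = Real.exp (-(2 * Real.pi * w.im)) := by
  rw [e, Complex.norm_exp]
  simp

lemma cocycle_eq_denom (γ : SL(2, ℤ)) (z : ℍ) : cocycle γ z = denom γ z := by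
  simp [cocycle, ModularGroup.denom_apply]

lemma cocycle_ne_zero (γ : SL(2, ℤ)) (z : ℍ) : cocycle γ z ≠ 0 := by
  rw [cocycle_eq_denom]
  exact denom_ne_zero _ z

lemma coe_smul_eq_div_cocycle (γ : SL(2, ℤ)) (z : ℍ) :
    ((γ • z : ℍ) : ℂ) = (((γ 0 0 : ℤ) : ℂ) * z + ((γ 0 1 : ℤ) : ℂ)) / cocycle γ z := by
  rw [coe_specialLinearGroup_apply]
  simp [cocycle]

lemma im_smul_eq_div_cocycle (γ : SL(2, ℤ)) (z : ℍ) :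
    (γ • z).im = z.im / ‖cocycle γ z‖ ^ 2 := by
  rw [ModularGroup.im_smul_eq_div_normSq, cocycle_eq_denom, Complex.normSq_eq_norm_sq]

lemma cocycle_mul (γ δ : SL(2, ℤ)) (z : ℍ) :
    cocycle (γ * δ) z = cocycle γ (δ • z) * cocycle δ z := by
  have h := cocycle_ne_zero δ z
  rw [cocycle, cocycle, coe_smul_eq_div_cocycle, Matrix.SpecialLinearGroup.coe_mul]
  simp only [Matrix.mul_apply, Fin.sum_univ_two]
  field_simp
  simp only [cocycle]
  push_cast
  ring

lemma det_eq_one (γ : SL(2, ℤ)) : γ 0 0 * γ 1 1 - γ 0 1 * γ 1 0 = 1 := by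
  have := γ.2
  rwa [Matrix.det_fin_two] at this

lemma isCoprime_row (γ : SL(2, ℤ)) : IsCoprime (γ 1 0) (γ 1 1) :=
  ⟨-γ 0 1, γ 0 0, by linarith [det_eq_one γ]⟩

/-- `γ z = a / c - 1 / (c (c z + d))` -/
lemma coe_smul_eq_sub (γ : SL(2, ℤ)) (hc : γ 1 0 ≠ 0) (z : ℍ) :
    ((γ • z : ℍ) : ℂ) = ((γ 0 0 : ℤ) : ℂ) / ((γ 1 0 : ℤ) : ℂ)
      - 1 / (((γ 1 0 : ℤ) : ℂ) * cocycle γ z) := by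
  have hc' : ((γ 1 0 : ℤ) : ℂ) ≠ 0 := by exact_mod_cast hc
  have h := cocycle_ne_zero γ z
  have hd : ((γ 0 0 : ℤ) : ℂ) * ((γ 1 1 : ℤ) : ℂ) - ((γ 0 1 : ℤ) : ℂ) * ((γ 1 0 : ℤ) : ℂ) = 1 := by
    exact_mod_cast det_eq_one γ
  rw [coe_smul_eq_div_cocycle]
  field_simp
  simp only [cocycle]
  linear_combination -hd

/-- `(0)_n = 0` for `n > 0`. This is the case `m > 0` at `s = k/2`. -/
lemma kummerM_zero_left (b x : ℂ) : kummerM 0 b x = 1 := by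
  rw [kummerM, tsum_eq_single 0]
  · simp
  · intro n hn
    simp [hn]

/-- The Pochhammer symbols cancel, being nonzero for `k > 0`. This is the case `m < 0` at `s = k/2`.
-/
lemma kummerM_self (k : ℝ) (hk : 0 < k) (x : ℂ) : kummerM k k x = Complex.exp x := by
  rw [kummerM, Complex.exp_eq_exp_ℂ, NormedSpace.exp_eq_tsum_div]
  refine tsum_congr fun n => ?_
  have h : (ascPochhammer ℂ n).eval (k : ℂ) ≠ 0 := by
    have h1 : (0 : ℝ) < (ascPochhammer ℝ n).eval k := ascPochhammer_pos n k hk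
    have h2 : (ascPochhammer ℂ n).eval (k : ℂ) = ((ascPochhammer ℝ n).eval k : ℝ) := by
      rw [← ascPochhammer_map Complex.ofRealHom, Polynomial.eval_map]
      exact (Polynomial.hom_eval₂ _ (RingHom.id ℝ) Complex.ofRealHom k).symm
    rw [h2]
    exact_mod_cast h1.ne'
  rw [div_self h, one_mul]

lemma Gamma_wt_ne_zero {κ : ℤ} (hk : 0 < wt κ) : Complex.Gamma (wt κ) ≠ 0 :=
  Complex.Gamma_ne_zero_of_re_pos (by simpa using hk)

/-- At `s = k / 2` the seed of the Poincaré series is a multiple of `q ^ m`. -/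
lemma phi_half_weight (κ m : ℤ) (hk : 0 < wt κ) (z : ℍ) :
    phi κ m ((wt κ : ℂ) / 2) z = delta κ m / Complex.Gamma (wt κ) * e ((m : ℂ) * (z : ℂ)) := by
  have hy := z.im_pos
  have hz : (z : ℂ) = (z.re : ℂ) + (z.im : ℂ) * Complex.I := (Complex.re_add_im _).symm
  have hez : e ((m : ℂ) * (z : ℂ)) =
      Complex.exp (-(2 * Real.pi * m * z.im : ℝ)) * e ((m : ℂ) * (z.re : ℂ)) := by
    rw [e, e, ← Complex.exp_add, hz]
    congr 1
    push_cast
    linear_combination (2 * Real.pi * m * z.im : ℂ) * Complex.I_sq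
  rcases eq_or_ne m 0 with rfl | hm
  · simp [phi, calM, delta, e, Gamma_wt_ne_zero hk]
  · have hY : (0 : ℝ) < 4 * Real.pi * |(m : ℝ)| * z.im := by
      have : (0 : ℝ) < |(m : ℝ)| := by simpa using hm
      positivity
    set Y : ℝ := 4 * Real.pi * |(m : ℝ)| * z.im with hYdef
    have hY0 : (Y : ℂ) ≠ 0 := by exact_mod_cast hY.ne'
    have hpow : (Y : ℂ) ^ (-((wt κ : ℂ) / 2)) * (Y : ℂ) ^ ((wt κ : ℂ) / 2) = 1 := by
      rw [← Complex.cpow_add _ _ hY0]; simp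
    have hkum : Complex.exp (-(Y : ℂ) / 2) *
        kummerM ((wt κ : ℂ) / 2 - (wt κ : ℂ) / 2 * (m.sign : ℂ)) (wt κ) Y
          = Complex.exp (-(2 * Real.pi * m * z.im : ℝ)) := by
      rcases lt_or_gt_of_ne hm with h | h
      · have habs : |(m : ℝ)| = -m := abs_of_neg (by exact_mod_cast h)
        have : (wt κ : ℂ) / 2 - (wt κ : ℂ) / 2 * ((m.sign : ℤ) : ℂ) = (wt κ : ℂ) := by
          rw [Int.sign_eq_neg_one_of_neg h]; push_cast; ring
        rw [this, kummerM_self _ hk, ← Complex.exp_add, hYdef, habs]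
        congr 1
        push_cast
        ring
      · have habs : |(m : ℝ)| = m := abs_of_pos (by exact_mod_cast h)
        have : (wt κ : ℂ) / 2 - (wt κ : ℂ) / 2 * ((m.sign : ℤ) : ℂ) = 0 := by
          rw [Int.sign_eq_one_of_pos h]; push_cast; ring
        rw [this, kummerM_zero_left, mul_one, hYdef, habs]
        congr 1
        push_cast
        ring
    rw [phi, calM, if_neg hm, whittakerM, ← hYdef, delta, if_neg hm, hez, ← hkum,
      show (wt κ : ℂ) / 2 - 1 / 2 + 1 / 2 = (wt κ : ℂ) / 2 by ring,
      show (wt κ : ℂ) / 2 - 1 / 2 - (wt κ : ℂ) / 2 * (m.sign : ℂ) + 1 / 2 =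
        (wt κ : ℂ) / 2 - (wt κ : ℂ) / 2 * (m.sign : ℂ) by ring,
      show 1 + 2 * ((wt κ : ℂ) / 2 - 1 / 2) = wt κ by ring,
      show 2 * ((wt κ : ℂ) / 2) = wt κ by ring]
    linear_combination ((Complex.Gamma (wt κ))⁻¹ * Complex.exp (-(Y : ℂ) / 2) *
      kummerM ((wt κ : ℂ) / 2 - (wt κ : ℂ) / 2 * (m.sign : ℂ)) (wt κ) Y *
      e ((m : ℂ) * (z.re : ℂ))) * hpow

end

section

/-! ### The theta multiplier -/

open scoped NumberTheorySymbols

/-- Write `c = 4a`. The square factor `4` drops out, and the symbol of `a` depends on the odd lower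
entry only modulo `4a = c`. -/
lemma jacobiSym_add_left_of_four_dvd {c b : ℕ} (hc : 4 ∣ c) (hb : b % 2 = 1) :
    J((c : ℤ) | b + c) = J((c : ℤ) | b) := by
  obtain ⟨a, rfl⟩ := hc
  have h4 : ∀ b' : ℕ, b' % 2 = 1 → J(((4 * a : ℕ) : ℤ) | b') = J((a : ℤ) | b') := by
    intro b' hb'
    rw [← jacobiSym.div_four_left (by push_cast; omega) hb']
    congr 1
    push_cast
    omega
  rw [h4 _ (by omega), h4 _ hb, jacobiSym.mod_right _ (Nat.odd_iff.mpr (by omega)),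
    jacobiSym.mod_right _ (Nat.odd_iff.mpr hb)]
  simp

/-- Modulo `b` the number `c` is `b'`, and modulo `b'` it is `b`. As `4 ∣ b + b'` with `b` odd, one
of the two is `1` modulo `4`, so reciprocity has no sign. This handles the step where `d` is
negative and `d + c` is not. -/
lemma jacobiSym_eq_of_add_eq {c b b' : ℕ} (hc : 4 ∣ c) (hb : b % 2 = 1) (h : b + b' = c) :
    J((c : ℤ) | b) = J((c : ℤ) | b') := by
  have h1 : J((c : ℤ) | b) = J((b' : ℤ) | b) :=
    jacobiSym.mod_left' (by rw [← h]; push_cast; simp)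
  have h2 : J((c : ℤ) | b') = J((b : ℤ) | b') :=
    jacobiSym.mod_left' (by rw [← h]; push_cast; simp)
  rw [h1, h2]
  rcases (by omega : b % 4 = 1 ∨ b' % 4 = 1) with h4 | h4
  · exact (jacobiSym.quadratic_reciprocity_one_mod_four h4 (Nat.odd_iff.mpr (by omega))).symm
  · exact jacobiSym.quadratic_reciprocity_one_mod_four h4 (Nat.odd_iff.mpr hb)

lemma quadSymbol_add_right {c d : ℤ} (hc : 0 < c) (h4 : 4 ∣ c) (hd : d % 2 = 1) :
    quadSymbol c (d + c) = quadSymbol c d := by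
  lift c to ℕ using hc.le
  have h4' : 4 ∣ c := by omega
  simp only [quadSymbol, hc.not_gt, false_and, if_false, one_mul]
  rcases lt_or_ge d 0 with h | h
  · rcases lt_or_ge (d + c) 0 with h' | h'
    · have : d.natAbs = (d + c).natAbs + c := by omega
      rw [this, jacobiSym_add_left_of_four_dvd h4' (by omega)]
    · exact jacobiSym_eq_of_add_eq h4' (by omega) (by omega)
  · rw [show (d + c).natAbs = d.natAbs + c by omega,
      jacobiSym_add_left_of_four_dvd h4' (by omega)]

lemma eps_add_of_four_dvd {c d : ℤ} (h4 : 4 ∣ c) : eps (d + c) = eps d := by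
  unfold eps
  rw [show (d + c) % 4 = d % 4 by omega]

/-- The multiplier `(c/d)^{2k} ε_d^{2k}` in half-integral weight, and `1` in integral weight. -/
def multiplier (κ c d : ℤ) : ℂ :=
  if Even κ then 1 else (quadSymbol c d : ℂ) ^ κ * eps d ^ κ

/-- Periodicity in `d` makes the multiplier constant along a residue class modulo `c`, so it can be
pulled out of the sum over translates and into the Kloosterman sum. -/
lemma multiplier_add_mul {κ c : ℤ} (hκ : 4 ∣ κ ∨ (Odd κ ∧ 4 ∣ c)) (hc : 0 < c) {d : ℤ}
    (hcd : IsCoprime c d) (n : ℤ) : multiplier κ c (d + c * n) = multiplier κ c d := by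
  rcases hκ with ⟨l, rfl⟩ | ⟨hodd, h4⟩
  · have : Even (4 * l) := ⟨2 * l, by ring⟩
    simp [multiplier, this]
  · have hd : d % 2 = 1 := by
      obtain ⟨u, v, huv⟩ := hcd
      rcases Int.even_or_odd d with ⟨a, ha⟩ | h
      · obtain ⟨b, rfl⟩ := h4
        have : (2 : ℤ) ∣ 1 := ⟨u * 2 * b + v * a, by rw [← huv, ha]; ring⟩
        omega
      · exact Int.odd_iff.mp h
    have hmod : ∀ n, (d + c * n) % 2 = 1 := by
      intro n
      obtain ⟨b, rfl⟩ := h4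
      rw [show d + 4 * b * n = d + 2 * (2 * b * n) by ring]
      omega
    have hstep : ∀ n, multiplier κ c (d + c * (n + 1)) = multiplier κ c (d + c * n) := by
      intro n
      simp only [multiplier]
      rw [show d + c * (n + 1) = (d + c * n) + c by ring, quadSymbol_add_right hc h4 (hmod n),
        eps_add_of_four_dvd h4]
    induction n using Int.induction_on with
    | zero => simp
    | succ i ih => rw [hstep, ih]
    | pred i ih => rw [← hstep, sub_add_cancel, ih]

lemma norm_eps (d : ℤ) : ‖eps d‖ = 1 := by
  unfold eps
  split_ifs <;> simp

lemma quadSymbol_trichotomy (c d : ℤ) :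
    quadSymbol c d = 0 ∨ quadSymbol c d = 1 ∨ quadSymbol c d = -1 := by
  unfold quadSymbol
  rcases jacobiSym.trichotomy c d.natAbs with h | h | h <;> split_ifs <;> simp [h]

lemma quadSymbol_ne_zero {c d : ℤ} (h : IsCoprime c d) : quadSymbol c d ≠ 0 := by
  unfold quadSymbol
  have : J(c | d.natAbs) ≠ 0 := by
    apply jacobiSym.ne_zero
    rw [Int.isCoprime_iff_gcd_eq_one] at h
    simpa [Int.gcd, Int.natAbs_abs] using h
  split_ifs <;> simpa using this

lemma norm_multiplier (κ : ℤ) {c d : ℤ} (h : IsCoprime c d) : ‖multiplier κ c d‖ = 1 := by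
  unfold multiplier
  split_ifs with hκ
  · simp
  · rw [norm_mul, norm_zpow, norm_zpow, norm_eps, one_zpow, mul_one]
    rcases (quadSymbol_trichotomy c d).resolve_left (quadSymbol_ne_zero h) with h | h <;> simp [h]

lemma norm_multiplier_le (κ c d : ℤ) : ‖multiplier κ c d‖ ≤ 1 := by
  unfold multiplier
  split_ifs with hκ
  · simp
  · rw [norm_mul, norm_zpow, norm_zpow, norm_eps, one_zpow, mul_one]
    -- Without coprimality the symbol may be `0`, and `0 ^ κ` would be `1` at `κ = 0`.
    have h0 : κ ≠ 0 := by rintro rfl; exact hκ ⟨0, rfl⟩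
    rcases quadSymbol_trichotomy c d with h | h | h <;> simp [h, zero_zpow _ h0]

/-- A symbol with values in `{0, 1, -1}` is its own inverse, so the exponent `-κ` may be replaced by
`κ`; an integer power of the principal root is a principal power. -/
lemma jFactor_zpow (κ : ℤ) (γ : SL(2, ℤ)) (z : ℍ) :
    jFactor κ γ z ^ (-κ) =
      multiplier κ (γ 1 0) (γ 1 1) * cocycle γ z ^ (-(wt κ : ℂ)) := by
  have h : (cocycle γ z ^ (1 / 2 : ℂ)) ^ (-κ) = cocycle γ z ^ (-(wt κ : ℂ)) := by
    rw [← Complex.cpow_mul_int]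
    congr 1
    simp [wt]
    ring
  unfold jFactor multiplier
  split_ifs with hκ
  · rw [h, one_mul]
  · rw [mul_zpow, mul_zpow, h, inv_zpow', neg_neg]
    congr 2
    rcases quadSymbol_trichotomy (γ 1 0) (γ 1 1) with h | h | h
    · have h0 : κ ≠ 0 := by rintro rfl; exact hκ ⟨0, rfl⟩
      simp [h, zero_zpow _ h0]
    · simp [h]
    · simp only [h, zpow_neg, Int.cast_neg, Int.cast_one]
      rw [← inv_zpow]; norm_num

/-- The matrix `[1, 0; 4, 1]`. -/
def lowerFour : SL(2, ℤ) := ⟨!![1, 0; 4, 1], by simp [Matrix.det_fin_two]⟩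

/-! ### Generators of `Γ₀(4)` -/

lemma mem_Gamma0_iff_dvd {N : ℕ} {γ : SL(2, ℤ)} :
    γ ∈ CongruenceSubgroup.Gamma0 N ↔ (N : ℤ) ∣ γ 1 0 := by
  rw [CongruenceSubgroup.Gamma0_mem]
  exact ZMod.intCast_zmod_eq_zero_iff_dvd _ _

lemma eq_T_zpow_or_of_lower_left_eq_zero (γ : SL(2, ℤ)) (hc : γ 1 0 = 0) :
    ∃ n : ℤ, γ = ModularGroup.T ^ n ∨ γ = -ModularGroup.T ^ n := by
  have hd := det_eq_one γ
  rw [hc, mul_zero, sub_zero] at hd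
  rcases Int.isUnit_iff.mp (IsUnit.of_mul_eq_one_right _ hd) with h1 | h1
  · refine ⟨γ 0 1, Or.inl ?_⟩
    rw [h1, mul_one] at hd
    ext i j
    fin_cases i <;> fin_cases j <;> simp [ModularGroup.coe_T_zpow, hc, h1, hd]
  · refine ⟨-γ 0 1, Or.inr ?_⟩
    have hd' : γ 0 0 = -1 := by rw [h1] at hd; linarith
    ext i j
    fin_cases i <;> fin_cases j <;> simp [ModularGroup.coe_T_zpow, hc, h1, hd']

lemma lowerFour_mem : lowerFour ∈ CongruenceSubgroup.Gamma0 4 := by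
  rw [mem_Gamma0_iff_dvd]; simp [lowerFour]

lemma T_mem_Gamma0 (N : ℕ) : ModularGroup.T ∈ CongruenceSubgroup.Gamma0 N := by
  rw [mem_Gamma0_iff_dvd]; simp [ModularGroup.T]

lemma neg_one_mem_Gamma0 (N : ℕ) : (-1 : SL(2, ℤ)) ∈ CongruenceSubgroup.Gamma0 N := by
  rw [mem_Gamma0_iff_dvd]; simp

lemma mul_row (γ δ : SL(2, ℤ)) (j : Fin 2) :
    (γ * δ) 1 j = γ 1 0 * δ 0 j + γ 1 1 * δ 1 j := by
  rw [Matrix.SpecialLinearGroup.coe_mul, Matrix.mul_apply, Fin.sum_univ_two]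

lemma coe_lowerFour_inv : (lowerFour⁻¹ : SL(2, ℤ)).1 = !![1, 0; -4, 1] := by
  rw [Matrix.SpecialLinearGroup.coe_inv, lowerFour, Matrix.adjugate_fin_two_of, neg_zero]

lemma mul_T_row (γ : SL(2, ℤ)) :
    (γ * ModularGroup.T) 1 0 = γ 1 0 ∧ (γ * ModularGroup.T) 1 1 = γ 1 1 + γ 1 0 := by
  rw [mul_row, mul_row, ModularGroup.coe_T]
  simp [add_comm]

lemma mul_T_inv_row (γ : SL(2, ℤ)) :
    (γ * ModularGroup.T⁻¹) 1 0 = γ 1 0 ∧ (γ * ModularGroup.T⁻¹) 1 1 = γ 1 1 - γ 1 0 := by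
  rw [mul_row, mul_row, ModularGroup.coe_T_inv]
  simp [sub_eq_neg_add]

lemma mul_lowerFour_row (γ : SL(2, ℤ)) :
    (γ * lowerFour) 1 0 = γ 1 0 + 4 * γ 1 1 ∧ (γ * lowerFour) 1 1 = γ 1 1 := by
  rw [mul_row, mul_row, lowerFour]
  simp [mul_comm]

lemma mul_lowerFour_inv_row (γ : SL(2, ℤ)) :
    (γ * lowerFour⁻¹) 1 0 = γ 1 0 - 4 * γ 1 1 ∧ (γ * lowerFour⁻¹) 1 1 = γ 1 1 := by
  rw [mul_row, mul_row, coe_lowerFour_inv]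
  simp [mul_comm, sub_eq_add_neg]

/-- `Γ₀(4)` is generated by `T`, `[1, 0; 4, 1]` and `-1`. -/
lemma Gamma0_four_le (G : Subgroup SL(2, ℤ)) (hT : ModularGroup.T ∈ G) (hU : lowerFour ∈ G)
    (hneg : -1 ∈ G) : CongruenceSubgroup.Gamma0 4 ≤ G := by
  suffices H : ∀ (n : ℕ) (γ : SL(2, ℤ)), γ ∈ CongruenceSubgroup.Gamma0 4 →
      (γ 1 0).natAbs + (γ 1 1).natAbs = n → γ ∈ G from fun γ hγ => H _ γ hγ rfl
  intro n
  induction n using Nat.strong_induction_on with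
  | _ n ih =>
    intro γ hγ hn
    have hd := odd_of_mem_Gamma0 (dvd_refl 4) hγ
    have hc := mem_Gamma0_iff_dvd.mp hγ
    have step : ∀ g ∈ G, g ∈ CongruenceSubgroup.Gamma0 4 →
        ((γ * g) 1 0).natAbs + ((γ * g) 1 1).natAbs < n → γ ∈ G := by
      intro g hg hg4 hlt
      have := ih _ hlt (γ * g) (mul_mem hγ hg4) rfl
      simpa using mul_mem this (inv_mem hg)
    push_cast at hc
    rcases eq_or_ne (γ 1 0) 0 with h0 | h0
    · obtain ⟨j, hj | hj⟩ := eq_T_zpow_or_of_lower_left_eq_zero γ h0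
      · rw [hj]; exact zpow_mem hT j
      · rw [hj, ← neg_one_mul]; exact mul_mem hneg (zpow_mem hT j)
    -- Descent on `|c| + |d|`: if `2|d| < |c|`, change `c` by `±4d`, otherwise `d` by `±c`. Both
    -- decrease strictly because `d` is odd and `4 ∣ c`, which excludes `2|d| = |c|`.
    · rcases lt_or_ge (2 * (γ 1 1).natAbs) (γ 1 0).natAbs with h | h
      · rcases le_total 0 (γ 1 0 * γ 1 1) with hs | hs
        · refine step lowerFour⁻¹ (inv_mem hU) (inv_mem lowerFour_mem) ?_
          rw [(mul_lowerFour_inv_row γ).1, (mul_lowerFour_inv_row γ).2]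
          rcases mul_nonneg_iff.mp hs with ⟨h1, h2⟩ | ⟨h1, h2⟩ <;> omega
        · refine step lowerFour hU lowerFour_mem ?_
          rw [(mul_lowerFour_row γ).1, (mul_lowerFour_row γ).2]
          rcases mul_nonpos_iff.mp hs with ⟨h1, h2⟩ | ⟨h1, h2⟩ <;> omega
      · rcases le_total 0 (γ 1 0 * γ 1 1) with hs | hs
        · refine step ModularGroup.T⁻¹ (inv_mem hT) (inv_mem (T_mem_Gamma0 4)) ?_
          rw [(mul_T_inv_row γ).1, (mul_T_inv_row γ).2]
          rcases mul_nonneg_iff.mp hs with ⟨h1, h2⟩ | ⟨h1, h2⟩ <;> omega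
        · refine step ModularGroup.T hT (T_mem_Gamma0 4) ?_
          rw [(mul_T_row γ).1, (mul_T_row γ).2]
          rcases mul_nonpos_iff.mp hs with ⟨h1, h2⟩ | ⟨h1, h2⟩ <;> omega

/-! ### Cocycle relation for the half-integral automorphy factor -/

lemma jFactor_neg_of_odd {κ : ℤ} (hκ : Odd κ) {γ : SL(2, ℤ)}
    (hγ : γ ∈ CongruenceSubgroup.Gamma0 4) (z : ℍ) : jFactor κ (-γ) z = jFactor κ γ z := by
  have hd := odd_of_mem_Gamma0 (dvd_refl 4) hγ
  rcases lt_trichotomy (γ 1 0) 0 with h | h | h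
  · have := jFactor_neg_of_pos hκ (-γ) (by simpa using h)
      (by change (-(γ 1 1)) % 2 = 1; omega) z
    rw [neg_neg] at this
    exact this.symm
  · have hdet := det_eq_one γ
    rw [h, mul_zero, sub_zero] at hdet
    rcases Int.isUnit_iff.mp (IsUnit.of_mul_eq_one_right _ hdet) with h1 | h1
    · exact jFactor_one_neg_one hκ γ (-γ) h h1 (by simp [h]) (by simp [h1]) z
    · exact (jFactor_one_neg_one hκ (-γ) γ (by simp [h]) (by simp [h1]) h h1 z).symm
  · exact jFactor_neg_of_pos hκ γ h hd z

lemma neg_mem_Gamma0 {N : ℕ} {γ : SL(2, ℤ)} (hγ : γ ∈ CongruenceSubgroup.Gamma0 N) :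
    -γ ∈ CongruenceSubgroup.Gamma0 N := by
  rw [← neg_one_mul]
  exact mul_mem (neg_one_mem_Gamma0 N) hγ

lemma cocycle_T (z : ℍ) : cocycle ModularGroup.T z = 1 := by
  simp [cocycle, ModularGroup.T]

lemma jFactor_one {κ : ℤ} (hκ : Odd κ) (z : ℍ) : jFactor κ 1 z = 1 := by
  have hev : ¬ Even κ := by simpa using hκ
  simp [jFactor, hev, cocycle, quadSymbol, eps]

lemma jFactor_T {κ : ℤ} (hκ : Odd κ) (z : ℍ) : jFactor κ ModularGroup.T z = 1 := by
  have hev : ¬ Even κ := by simpa using hκ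
  rw [jFactor, cocycle_T]
  simp [hev, quadSymbol, eps, ModularGroup.T]

/-- The row `(c, d)` becomes `(c, d + c)`, which changes neither the symbol nor `ε` once the sign of
`γ` is chosen with `c ≥ 0`. No branch question arises, since `T` has cocycle `1`. -/
lemma jFactor_mul_T {κ : ℤ} (hκ : Odd κ) {γ : SL(2, ℤ)}
    (hγ : γ ∈ CongruenceSubgroup.Gamma0 4) (z : ℍ) :
    jFactor κ (γ * ModularGroup.T) z = jFactor κ γ (ModularGroup.T • z) := by
  wlog hc : 0 ≤ γ 1 0 generalizing γ
  · have := this (neg_mem_Gamma0 hγ) (by simp at hc ⊢; omega)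
    rwa [neg_mul, jFactor_neg_of_odd hκ (mul_mem hγ (T_mem_Gamma0 4)),
      jFactor_neg_of_odd hκ hγ] at this
  have hd := odd_of_mem_Gamma0 (dvd_refl 4) hγ
  have h4 : (4 : ℤ) ∣ γ 1 0 := by exact_mod_cast mem_Gamma0_iff_dvd.mp hγ
  unfold jFactor
  rw [cocycle_mul, cocycle_T, mul_one, (mul_T_row γ).1, (mul_T_row γ).2]
  rcases hc.eq_or_lt with h0 | h0
  · rw [← h0, add_zero]
  · rw [quadSymbol_add_right h0 h4 hd, eps_add_of_four_dvd h4]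

lemma mul_cpow_half {v w : ℂ} (hv : v ≠ 0) (hw : w ≠ 0) (h1 : -Real.pi < v.arg + w.arg)
    (h2 : v.arg + w.arg ≤ Real.pi) :
    (v * w) ^ (1 / 2 : ℂ) = v ^ (1 / 2 : ℂ) * w ^ (1 / 2 : ℂ) := by
  rw [Complex.cpow_def_of_ne_zero (mul_ne_zero hv hw), Complex.cpow_def_of_ne_zero hv,
    Complex.cpow_def_of_ne_zero hw, Complex.log_mul hv hw ⟨h1, h2⟩, add_mul, Complex.exp_add]

lemma arg_pos_of_im_pos {w : ℂ} (h : 0 < w.im) : 0 < w.arg := by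
  refine lt_of_le_of_ne (Complex.arg_nonneg_iff.mpr h.le) fun h0 => ?_
  exact h.ne' (Complex.arg_eq_zero_iff.mp h0.symm).2

lemma arg_lt_pi_of_im_pos {w : ℂ} (h : 0 < w.im) : w.arg < Real.pi :=
  Complex.arg_lt_pi_iff.mpr (Or.inr h.ne')

/-- The root is multiplicative when the arguments add up inside `(-π, π]`. If `v` lies below the
real axis, the two arguments have opposite signs. Otherwise their sum lies in `(0, 2π)`, since `v`
is not a negative real, and `Im (v w) ≥ 0` excludes `(π, 2π)`, where the sine is negative. -/
lemma mul_cpow_half_of_im {v w : ℂ} (hv : v ≠ 0) (hw : 0 < w.im)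
    (h : v.im < 0 ∨ 0 ≤ v.im ∧ 0 ≤ (v * w).im) (hv' : 0 < v.re ∨ v.im ≠ 0) :
    (v * w) ^ (1 / 2 : ℂ) = v ^ (1 / 2 : ℂ) * w ^ (1 / 2 : ℂ) := by
  have hw0 : w ≠ 0 := by rintro rfl; simp at hw
  have hwp := arg_pos_of_im_pos hw
  have hwl := arg_lt_pi_of_im_pos hw
  have hvl := Complex.neg_pi_lt_arg v
  have hvp : v.arg < Real.pi := Complex.arg_lt_pi_iff.mpr (hv'.imp le_of_lt id)
  rcases h with h | ⟨h, h'⟩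
  · have := Complex.arg_neg_iff.mpr h
    exact mul_cpow_half hv hw0 (by linarith) (by linarith)
  · have hv0 := Complex.arg_nonneg_iff.mpr h
    refine mul_cpow_half hv hw0 (by linarith) ?_
    by_contra hgt
    push Not at hgt
    have him : (v * w).im = ‖v * w‖ * Real.sin (v.arg + w.arg) := by
      conv_lhs => rw [← Complex.norm_mul_exp_arg_mul_I v, ← Complex.norm_mul_exp_arg_mul_I w]
      rw [mul_mul_mul_comm, ← Complex.exp_add, ← add_mul, ← Complex.ofReal_add,
        ← Complex.ofReal_mul, Complex.im_ofReal_mul, Complex.exp_ofReal_mul_I_im, norm_mul]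
    have hs : Real.sin (v.arg + w.arg) < 0 := by
      rw [← Real.sin_sub_two_pi]
      exact Real.sin_neg_of_neg_of_neg_pi_lt (by linarith) (by linarith)
    have hn : 0 < ‖v * w‖ := norm_pos_iff.mpr (mul_ne_zero hv hw0)
    nlinarith

lemma im_cocycle (γ : SL(2, ℤ)) (z : ℍ) : (cocycle γ z).im = γ 1 0 * z.im := by
  simp [cocycle]

/-- The row `(c, d)` becomes `(c + 4d, d)`. Choosing the sign with `d > 0` removes the sign
correction of the symbol, which then depends on `c` only modulo `d`; it also ensures that `c ≥ 0`
forces `c + 4d ≥ 0`, so that the square roots multiply. -/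
lemma jFactor_mul_lowerFour {κ : ℤ} (hκ : Odd κ) {γ : SL(2, ℤ)}
    (hγ : γ ∈ CongruenceSubgroup.Gamma0 4) (z : ℍ) :
    jFactor κ (γ * lowerFour) z = jFactor κ γ (lowerFour • z) * jFactor κ lowerFour z := by
  have hd2 := odd_of_mem_Gamma0 (dvd_refl 4) hγ
  wlog hd : 0 < γ 1 1 generalizing γ
  · have := this (neg_mem_Gamma0 hγ) (by simp; omega) (by simp at hd ⊢; omega)
    rwa [neg_mul, jFactor_neg_of_odd hκ (mul_mem hγ lowerFour_mem),
      jFactor_neg_of_odd hκ hγ] at this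
  have hev : ¬ Even κ := by simpa using hκ
  have hq : quadSymbol (γ 1 0 + 4 * γ 1 1) (γ 1 1) = quadSymbol (γ 1 0) (γ 1 1) := by
    simp only [quadSymbol, hd.not_gt, and_false, if_false, one_mul]
    apply jacobiSym.mod_left'
    rw [Int.natCast_natAbs, abs_of_pos hd]
    exact Int.add_mul_emod_self_right _ _ _
  have hroot : cocycle (γ * lowerFour) z ^ (1 / 2 : ℂ) =
      cocycle γ (lowerFour • z) ^ (1 / 2 : ℂ) * cocycle lowerFour z ^ (1 / 2 : ℂ) := by
    rw [cocycle_mul]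
    apply mul_cpow_half_of_im (cocycle_ne_zero _ _)
    · rw [im_cocycle]
      have := z.im_pos
      simp [lowerFour, this]
    · rw [← cocycle_mul, im_cocycle, im_cocycle, (mul_lowerFour_row γ).1]
      have h1 := z.im_pos
      have h2 := (lowerFour • z).im_pos
      rcases lt_or_ge (γ 1 0) 0 with h | h
      · left
        have : ((γ 1 0 : ℤ) : ℝ) < 0 := by exact_mod_cast h
        nlinarith
      · right
        have hc : (0 : ℝ) ≤ ((γ 1 0 : ℤ) : ℝ) := by exact_mod_cast h
        have hc' : (0 : ℝ) ≤ ((γ 1 0 + 4 * γ 1 1 : ℤ) : ℝ) := by exact_mod_cast (by omega)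
        exact ⟨by positivity, by positivity⟩
    · rcases eq_or_ne (γ 1 0) 0 with h | h
      · left
        simp [cocycle, h, hd]
      · right
        rw [im_cocycle]
        have h2 := (lowerFour • z).im_pos.ne'
        have : ((γ 1 0 : ℤ) : ℝ) ≠ 0 := by exact_mod_cast h
        positivity
  have hU : jFactor κ lowerFour z = cocycle lowerFour z ^ (1 / 2 : ℂ) := by
    simp [jFactor, hev, lowerFour, quadSymbol, eps]
  rw [hU]
  simp only [jFactor, hev, if_false]
  rw [(mul_lowerFour_row γ).1, (mul_lowerFour_row γ).2, hq, hroot]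
  ring

/-- The theta multiplier satisfies the cocycle relation on `Γ₀(4)`. -/
lemma jFactor_mul {κ : ℤ} (hκ : Odd κ) {γ δ : SL(2, ℤ)}
    (hγ : γ ∈ CongruenceSubgroup.Gamma0 4) (hδ : δ ∈ CongruenceSubgroup.Gamma0 4) (z : ℍ) :
    jFactor κ (γ * δ) z = jFactor κ γ (δ • z) * jFactor κ δ z := by
  -- For the right factor `δ`, the relation against all `γ` and all `z` defines a subgroup, so it
  -- need only be tested on generators.
  let G : Subgroup SL(2, ℤ) :=
    { carrier := {δ | δ ∈ CongruenceSubgroup.Gamma0 4 ∧ ∀ γ ∈ CongruenceSubgroup.Gamma0 4,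
        ∀ z : ℍ, jFactor κ (γ * δ) z = jFactor κ γ (δ • z) * jFactor κ δ z}
      one_mem' := ⟨one_mem _, fun γ _ z => by simp [jFactor_one hκ]⟩
      mul_mem' := by
        rintro a b ⟨ha, ha'⟩ ⟨hb, hb'⟩
        refine ⟨mul_mem ha hb, fun γ hγ z => ?_⟩
        rw [← mul_assoc, hb' _ (mul_mem hγ ha), ha' _ hγ, hb' _ ha, mul_smul, mul_assoc]
      inv_mem' := by
        rintro a ⟨ha, ha'⟩
        refine ⟨inv_mem ha, fun γ hγ z => ?_⟩
        have h1 := ha' _ (mul_mem hγ (inv_mem ha)) (a⁻¹ • z)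
        have h2 := ha' _ (inv_mem ha) (a⁻¹ • z)
        rw [inv_mul_cancel_right, smul_inv_smul] at h1
        rw [inv_mul_cancel, jFactor_one hκ, smul_inv_smul] at h2
        rw [h1, mul_assoc, mul_comm (jFactor κ a _), ← h2, mul_one] }
  have hG := Gamma0_four_le G
    ⟨T_mem_Gamma0 4, fun γ hγ z => by rw [jFactor_mul_T hκ hγ, jFactor_T hκ, mul_one]⟩
    ⟨lowerFour_mem, fun γ hγ z => jFactor_mul_lowerFour hκ hγ z⟩
    ⟨neg_one_mem_Gamma0 4, fun γ hγ z => by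
      rw [mul_neg_one, jFactor_neg_of_odd hκ hγ, jFactor_neg_of_odd hκ (one_mem _),
        jFactor_one hκ, mul_one, ModularGroup.SL_neg_smul, one_smul]⟩
  exact (hG hδ).2 γ hγ z

/-- If `4 ∣ κ`, the factor is an integer power of `cz + d` and no branch intervenes; otherwise
`Γ₀(N)` lies in `Γ₀(4)`. -/
lemma jFactor_zpow_mul {κ : ℤ} {N : ℕ} (hκ : 4 ∣ κ ∨ (Odd κ ∧ 4 ∣ N)) {γ δ : SL(2, ℤ)}
    (hγ : γ ∈ CongruenceSubgroup.Gamma0 N) (hδ : δ ∈ CongruenceSubgroup.Gamma0 N) (z : ℍ) :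
    jFactor κ (γ * δ) z ^ (-κ) = jFactor κ γ (δ • z) ^ (-κ) * jFactor κ δ z ^ (-κ) := by
  rcases hκ with ⟨l, rfl⟩ | ⟨hodd, hN⟩
  · have hev : Even (4 * l) := ⟨2 * l, by ring⟩
    have key : ∀ (γ : SL(2, ℤ)) (z : ℍ),
        jFactor (4 * l) γ z ^ (-(4 * l)) = cocycle γ z ^ (-(2 * l)) := by
      intro γ z
      rw [jFactor_zpow, multiplier, if_pos hev, one_mul, ← Complex.cpow_intCast]
      congr 1
      simp [wt]
      ring
    rw [key, key, key, cocycle_mul, mul_zpow]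
  · have h : CongruenceSubgroup.Gamma0 N ≤ CongruenceSubgroup.Gamma0 4 := by
      intro g hg
      rw [mem_Gamma0_iff_dvd] at hg ⊢
      exact dvd_trans (by exact_mod_cast hN) hg
    rw [jFactor_mul hodd (h hγ) (h hδ), mul_zpow]

end

section

/-! ### Lipschitz's formula -/

open MeasureTheory Filter Topology Asymptotics

lemma continuousOn_rpow_mul_exp (a : ℝ) (r : ℂ) :
    ContinuousOn (fun t : ℝ => ((t ^ (a - 1) : ℝ) : ℂ) * Complex.exp (-(r * t))) (Set.Ioi 0) := by
  refine ContinuousOn.mul ?_ (by fun_prop)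
  refine Complex.continuous_ofReal.comp_continuousOn fun t ht => ?_
  exact (Real.continuousAt_rpow_const t _ (Or.inl (ne_of_gt ht))).continuousWithinAt

lemma integrableOn_rpow_mul_exp {a b : ℝ} (ha : 0 < a) (hb : 0 < b) :
    IntegrableOn (fun t : ℝ => t ^ (a - 1) * Real.exp (-(b * t))) (Set.Ioi 0) := by
  have := integrableOn_rpow_mul_exp_neg_mul_rpow (p := 1) (s := a - 1) (b := b) (by linarith)
    one_pos hb
  simpa using this

lemma norm_rpow_mul_exp {a : ℝ} {r : ℂ} {t : ℝ} (ht : 0 < t) :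
    ‖((t ^ (a - 1) : ℝ) : ℂ) * Complex.exp (-(r * t))‖ =
      t ^ (a - 1) * Real.exp (-(r.re * t)) := by
  rw [norm_mul, Complex.norm_real, Real.norm_of_nonneg (by positivity), Complex.norm_exp]
  simp

lemma integrableOn_rpow_mul_cexp {a : ℝ} (ha : 0 < a) {r : ℂ} (hr : 0 < r.re) :
    IntegrableOn (fun t : ℝ => ((t ^ (a - 1) : ℝ) : ℂ) * Complex.exp (-(r * t))) (Set.Ioi 0) := by
  refine Integrable.mono' (integrableOn_rpow_mul_exp ha hr)
    ((continuousOn_rpow_mul_exp a r).aestronglyMeasurable measurableSet_Ioi) ?_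
  filter_upwards [ae_restrict_mem measurableSet_Ioi] with t ht
  exact (norm_rpow_mul_exp ht).le

lemma differentiableAt_integral_rpow_mul_cexp {a : ℝ} (ha : 0 < a) {r : ℂ} (hr : 0 < r.re) :
    DifferentiableAt ℂ (fun r : ℂ =>
      ∫ t in Set.Ioi (0 : ℝ), ((t ^ (a - 1) : ℝ) : ℂ) * Complex.exp (-(r * t))) r := by
  have hre : ∀ r' ∈ Metric.ball r (r.re / 2), r.re / 2 < r'.re := by
    intro r' hr'
    have h1 := Complex.abs_re_le_norm (r' - r)
    rw [Metric.mem_ball, dist_eq_norm] at hr'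
    have := (abs_lt.mp (h1.trans_lt hr')).1
    simp only [Complex.sub_re] at this
    linarith
  refine (hasDerivAt_integral_of_dominated_loc_of_deriv_le (μ := volume.restrict (Set.Ioi (0 : ℝ)))
    (F := fun (r : ℂ) (t : ℝ) => ((t ^ (a - 1) : ℝ) : ℂ) * Complex.exp (-(r * t)))
    (F' := fun (r : ℂ) (t : ℝ) => -(((t ^ (a + 1 - 1) : ℝ) : ℂ) * Complex.exp (-(r * t))))
    -- On the ball of radius `Re r / 2` every `r'` has real part above `Re r / 2`, which gives a
    -- common integrable majorant for the derivative.
    (bound := fun t => t ^ (a + 1 - 1) * Real.exp (-(r.re / 2 * t)))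
    (Metric.ball_mem_nhds r (half_pos hr))
    ?_ (integrableOn_rpow_mul_cexp ha hr) ?_ ?_ (integrableOn_rpow_mul_exp (by linarith)
      (half_pos hr)) ?_).2.differentiableAt
  · exact Eventually.of_forall fun r' =>
      (continuousOn_rpow_mul_exp a r').aestronglyMeasurable measurableSet_Ioi
  · exact ((continuousOn_rpow_mul_exp (a + 1) r).aestronglyMeasurable measurableSet_Ioi).neg
  · filter_upwards [ae_restrict_mem measurableSet_Ioi] with t ht r' hr'
    have ht : (0 : ℝ) < t := ht
    rw [norm_neg, norm_rpow_mul_exp ht]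
    have := hre r' hr'
    gcongr
  · filter_upwards [ae_restrict_mem measurableSet_Ioi] with t ht r' hr'
    have ht : (0 : ℝ) < t := ht
    have h1 : HasDerivAt (fun r : ℂ => -(r * (t : ℂ))) (-(t : ℂ)) r' := by
      simpa using ((hasDerivAt_id r').mul_const (t : ℂ)).fun_neg
    have h2 := (h1.cexp).const_mul ((t ^ (a - 1) : ℝ) : ℂ)
    have h3 : t ^ (a + 1 - 1) = t ^ (a - 1) * t := by
      rw [← Real.rpow_add_one ht.ne']; congr 1; ring
    refine h2.congr_deriv ?_
    rw [h3]
    push_cast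
    ring

/-- `∫₀^∞ t ^ (a - 1) e ^ (-r t) dt = Γ(a) r ^ (-a)` for complex `r` with `Re r > 0`. -/
lemma integral_rpow_mul_cexp {a : ℝ} (ha : 0 < a) {r : ℂ} (hr : 0 < r.re) :
    ∫ t in Set.Ioi (0 : ℝ), ((t ^ (a - 1) : ℝ) : ℂ) * Complex.exp (-(r * t)) =
      Complex.Gamma a * r ^ (-(a : ℂ)) := by
  set U : Set ℂ := {r | 0 < r.re} with hU
  have hUo : IsOpen U := isOpen_lt continuous_const Complex.continuous_re
  have hUc : IsPreconnected U := (convex_halfSpace_re_gt 0).isPreconnected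
  have h1 : AnalyticOnNhd ℂ (fun r : ℂ =>
      ∫ t in Set.Ioi (0 : ℝ), ((t ^ (a - 1) : ℝ) : ℂ) * Complex.exp (-(r * t))) U :=
    DifferentiableOn.analyticOnNhd (fun r hr =>
      (differentiableAt_integral_rpow_mul_cexp ha hr).differentiableWithinAt) hUo
  have h2 : AnalyticOnNhd ℂ (fun r : ℂ => Complex.Gamma a * r ^ (-(a : ℂ))) U := by
    refine DifferentiableOn.analyticOnNhd (fun r hr => ?_) hUo
    have : r ∈ Complex.slitPlane := Or.inl hr
    exact ((differentiableAt_id.cpow_const this).const_mul _).differentiableWithinAt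
  refine h1.eqOn_of_preconnected_of_frequently_eq h2 hUc (z₀ := 1) (by simp [hU]) ?_ hr
  -- Identity theorem: both sides are holomorphic on `Re r > 0` and agree at the positive reals,
  -- which accumulate at `1`.
  have hlim : Tendsto (fun x : ℝ => (x : ℂ)) (𝓝[≠] 1) (𝓝[≠] 1) := by
    refine tendsto_nhdsWithin_iff.mpr ⟨?_, ?_⟩
    · exact (Complex.continuous_ofReal.tendsto' 1 1 (by simp)).mono_left nhdsWithin_le_nhds
    · filter_upwards [self_mem_nhdsWithin] with x hx
      simpa using hx
  refine hlim.frequently (Eventually.frequently ?_)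
  filter_upwards [mem_nhdsWithin_of_mem_nhds (Ioi_mem_nhds one_pos)] with x hx
  have hx : (0 : ℝ) < x := hx
  have h := Complex.integral_cpow_mul_exp_neg_mul_Ioi (a := a) (r := x) (by simpa using ha) hx
  rw [one_div, ← Complex.ofReal_inv, ← Complex.ofReal_cpow (inv_nonneg.mpr hx.le),
    Real.inv_rpow hx.le, ← Real.rpow_neg hx.le, mul_comm] at h
  rw [← Complex.ofReal_neg, ← Complex.ofReal_cpow hx.le, ← h]
  refine setIntegral_congr_fun measurableSet_Ioi fun t ht => ?_
  have ht : (0 : ℝ) < t := ht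
  rw [Complex.ofReal_cpow ht.le]
  push_cast
  rfl

lemma norm_sub_rpow_isBigO (w : ℂ) {a : ℝ} (ha : 0 ≤ a) :
    (fun x : ℝ => ‖w - x‖ ^ (-a)) =O[cocompact ℝ] (fun x : ℝ => |x| ^ (-a)) := by
  refine IsBigO.of_bound (2 ^ a) ?_
  have h := (tendsto_norm_cocompact_atTop (E := ℝ)).eventually_ge_atTop (2 * ‖w‖ + 1)
  filter_upwards [h] with x hx
  rw [Real.norm_eq_abs] at hx
  have hw := norm_nonneg w
  have h0 : |x| / 2 ≤ ‖w - x‖ := by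
    have := norm_sub_norm_le (x : ℂ) w
    rw [norm_sub_rev, Complex.norm_real, Real.norm_eq_abs] at this
    linarith
  have hx0 : 0 < |x| / 2 := by linarith
  rw [Real.norm_of_nonneg (by positivity), Real.norm_of_nonneg (by positivity)]
  calc ‖w - x‖ ^ (-a) ≤ (|x| / 2) ^ (-a) :=
        Real.rpow_le_rpow_of_nonpos hx0 h0 (by linarith)
    _ = 2 ^ a * |x| ^ (-a) := by
        rw [Real.div_rpow (by positivity) (by norm_num), Real.rpow_neg (by norm_num : (0:ℝ) ≤ 2)]
        field_simp

lemma summable_norm_add_int_rpow (w : ℂ) {a : ℝ} (ha : 1 < a) :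
    Summable (fun n : ℤ => ‖w + n‖ ^ (-a)) := by
  have h : Summable (fun n : ℤ => ‖w - (n : ℝ)‖ ^ (-a)) :=
    summable_of_isBigO (Real.summable_abs_int_rpow ha)
      ((norm_sub_rpow_isBigO w (by linarith)).comp_tendsto Int.tendsto_coe_cofinite)
  refine ((Equiv.neg ℤ).summable_iff.mpr h).congr fun n => ?_
  simp

/-- The function whose Fourier transform is a power of `w - x`. -/
def lipschitzKernel (a : ℝ) (w : ℂ) (t : ℝ) : ℂ := (((max t 0) ^ (a - 1) : ℝ) : ℂ) * e (t * w)

/-- Since `a > 1`, the power `t ^ (a - 1)` vanishes at `0`, so the cut-off there is continuous, as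
Poisson summation requires. -/
lemma continuous_lipschitzKernel {a : ℝ} (ha : 1 < a) (w : ℂ) :
    Continuous (lipschitzKernel a w) := by
  unfold lipschitzKernel e
  refine Continuous.mul (Complex.continuous_ofReal.comp ?_) (by fun_prop)
  exact (continuous_id.max continuous_const).rpow_const fun _ => Or.inr (by linarith)

lemma lipschitzKernel_of_nonpos {a : ℝ} (ha : 1 < a) (w : ℂ) {t : ℝ} (ht : t ≤ 0) :
    lipschitzKernel a w t = 0 := by
  simp [lipschitzKernel, max_eq_right ht, Real.zero_rpow (by linarith : a - 1 ≠ 0)]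

lemma lipschitzKernel_isBigO {a : ℝ} (ha : 1 < a) {w : ℂ} (hw : 0 < w.im) :
    lipschitzKernel a w =O[cocompact ℝ] (fun x : ℝ => |x| ^ (-a)) := by
  rw [cocompact_eq_atBot_atTop]
  refine IsBigO.sup ?_ ?_
  · refine IsBigO.of_bound 0 ?_
    filter_upwards [eventually_le_atBot 0] with t ht
    simp [lipschitzKernel_of_nonpos ha w ht]
  · have h1 : (fun t : ℝ => t ^ (a - 1) * Real.exp (-(2 * Real.pi * w.im) * t)) =O[atTop]
        (fun t : ℝ => t ^ (a - 1) * t ^ (-a - (a - 1))) :=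
      (isBigO_refl _ _).mul (isLittleO_exp_neg_mul_rpow_atTop (by positivity) _).isBigO
    refine (IsBigO.of_bound 1 ?_).trans (h1.trans (IsBigO.of_bound 1 ?_))
    · filter_upwards [eventually_gt_atTop 0] with t ht
      rw [lipschitzKernel, max_eq_left ht.le, norm_mul, Complex.norm_real, norm_mul, norm_e, one_mul,
        Real.norm_of_nonneg (Real.exp_pos _).le]
      simp only [Complex.im_ofReal_mul]
      apply le_of_eq
      congr 2
      ring
    · filter_upwards [eventually_gt_atTop 0] with t ht
      rw [← Real.rpow_add ht, one_mul, abs_of_pos ht]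
      apply le_of_eq
      congr 2
      ring

lemma ofReal_mul_cpow {x : ℝ} (hx : 0 < x) {u : ℂ} (hu : u ≠ 0) (s : ℂ) :
    ((x : ℂ) * u) ^ s = (x : ℂ) ^ s * u ^ s := by
  have hx0 : (x : ℂ) ≠ 0 := by exact_mod_cast hx.ne'
  rw [Complex.cpow_def_of_ne_zero (mul_ne_zero hx0 hu), Complex.cpow_def_of_ne_zero hx0,
    Complex.cpow_def_of_ne_zero hu, Complex.log_ofReal_mul hx hu, Complex.ofReal_log hx.le,
    add_mul, Complex.exp_add]

/-- Multiplying by `-i` turns the argument from `(0, π)` into `(-π/2, π/2)`, so the logarithms add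
without a jump. -/
lemma neg_I_mul_cpow {u : ℂ} (hu : 0 < u.im) (s : ℂ) :
    (-Complex.I * u) ^ (-s) = Complex.I ^ s * u ^ (-s) := by
  have hu0 : u ≠ 0 := by rintro rfl; simp at hu
  have h1 := arg_pos_of_im_pos hu
  have h2 := arg_lt_pi_of_im_pos hu
  have hI : (-Complex.I : ℂ) ≠ 0 := by simp
  rw [Complex.cpow_def_of_ne_zero (mul_ne_zero hI hu0), Complex.cpow_def_of_ne_zero hu0,
    Complex.cpow_def_of_ne_zero Complex.I_ne_zero, ← Complex.exp_add, Complex.log_mul hI hu0]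
  · rw [Complex.log_neg_I, Complex.log_I]
    congr 1
    ring
  · rw [Complex.arg_neg_I]
    constructor <;> linarith [Real.pi_pos]

/-- This is the Gamma integral at `r = -2πi (w - x)`, whose real part is `2π Im w > 0`. -/
lemma fourier_lipschitzKernel {a : ℝ} (ha : 1 < a) {w : ℂ} (hw : 0 < w.im) (x : ℝ) :
    FourierTransform.fourier (lipschitzKernel a w) x =
      Complex.Gamma a * (((2 * Real.pi) ^ (-a) : ℝ) : ℂ) * Complex.I ^ (a : ℂ) *
        (w - x) ^ (-(a : ℂ)) := by
  set r : ℂ := ((2 * Real.pi : ℝ) : ℂ) * (-Complex.I * (w - x)) with hr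
  have hrre : 0 < r.re := by
    rw [hr, Complex.re_ofReal_mul]
    simp
    positivity
  have hu : -Complex.I * (w - x) ≠ 0 := by
    intro h
    rw [hr, h] at hrre
    simp at hrre
  rw [Real.fourier_real_eq_integral_exp_smul]
  have h1 : ∀ t : ℝ, Complex.exp (((-2 * Real.pi * t * x : ℝ) : ℂ) * Complex.I) •
      lipschitzKernel a w t = (Set.Ioi (0 : ℝ)).indicator
        (fun t : ℝ => ((t ^ (a - 1) : ℝ) : ℂ) * Complex.exp (-(r * t))) t := by
    intro t
    rcases le_or_gt t 0 with ht | ht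
    · rw [lipschitzKernel_of_nonpos ha w ht, smul_zero, Set.indicator_of_notMem (by simpa using ht)]
    · rw [Set.indicator_of_mem (by simpa using ht), lipschitzKernel, max_eq_left ht.le, e,
        smul_eq_mul, mul_left_comm, ← Complex.exp_add]
      congr 2
      rw [hr]
      push_cast
      ring
  simp_rw [h1]
  rw [integral_indicator measurableSet_Ioi, integral_rpow_mul_cexp (by linarith) hrre, hr,
    ofReal_mul_cpow (by positivity) hu, neg_I_mul_cpow (by simpa using hw),
    Complex.ofReal_cpow (by positivity)]
  push_cast
  ring

lemma norm_cpow_neg_ofReal (u : ℂ) (a : ℝ) : ‖u ^ (-(a : ℂ))‖ = ‖u‖ ^ (-a) := by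
  rw [← Complex.ofReal_neg, Complex.norm_cpow_real]

/-- **Lipschitz's formula** for real exponents:
`∑_{n > 0} n ^ (a - 1) e(n w) = Γ(a) (2π) ^ (-a) i ^ a ∑_{n ∈ ℤ} (w + n) ^ (-a)`. -/
lemma hasSum_lipschitz {a : ℝ} (ha : 1 < a) {w : ℂ} (hw : 0 < w.im) :
    HasSum (fun n : ℕ+ => ((((n : ℕ) : ℝ) ^ (a - 1) : ℝ) : ℂ) * e (((n : ℕ) : ℂ) * w))
      (Complex.Gamma a * (((2 * Real.pi) ^ (-a) : ℝ) : ℂ) * Complex.I ^ (a : ℂ) *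
        ∑' n : ℤ, (w + n) ^ (-(a : ℂ))) := by
  have hbig := lipschitzKernel_isBigO ha hw
  have hF : FourierTransform.fourier (lipschitzKernel a w) =O[cocompact ℝ]
      (fun x : ℝ => |x| ^ (-a)) := by
    have h1 : FourierTransform.fourier (lipschitzKernel a w) =O[cocompact ℝ]
        (fun x : ℝ => ‖w - x‖ ^ (-a)) := by
      refine IsBigO.of_bound
        ‖Complex.Gamma a * (((2 * Real.pi) ^ (-a) : ℝ) : ℂ) * Complex.I ^ (a : ℂ)‖
        (Eventually.of_forall fun x => ?_)
      rw [fourier_lipschitzKernel ha hw, norm_mul, norm_cpow_neg_ofReal,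
        Real.norm_of_nonneg (by positivity)]
    exact h1.trans (norm_sub_rpow_isBigO w (by linarith))
  -- Poisson summation at `0`. The kernel and its transform both decay like `|x| ^ (-a)` with `a >
  -- 1`.
  have hP := Real.tsum_eq_tsum_fourier_of_rpow_decay (continuous_lipschitzKernel ha w) ha hbig hF 0
  have hsum : Summable (fun n : ℤ => lipschitzKernel a w n) :=
    summable_of_isBigO (Real.summable_abs_int_rpow ha)
      (hbig.comp_tendsto Int.tendsto_coe_cofinite)
  simp only [zero_add, QuotientAddGroup.mk_zero, fourier_eval_zero, mul_one] at hP
  have hval : ∑' n : ℤ, lipschitzKernel a w n = Complex.Gamma a *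
      (((2 * Real.pi) ^ (-a) : ℝ) : ℂ) * Complex.I ^ (a : ℂ) *
        ∑' n : ℤ, (w + n) ^ (-(a : ℂ)) := by
    -- The reflection `n ↦ -n` turns `w - n` into `w + n`.
    rw [hP, ← tsum_mul_left, ← (Equiv.neg ℤ).tsum_eq]
    refine tsum_congr fun n => ?_
    rw [fourier_lipschitzKernel ha hw]
    simp
  have hinj : Function.Injective (fun n : ℕ+ => ((n : ℕ) : ℤ)) := fun m n h => by
    simpa using h
  have h0 : ∀ n ∉ Set.range (fun n : ℕ+ => ((n : ℕ) : ℤ)), lipschitzKernel a w n = 0 := by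
    intro n hn
    refine lipschitzKernel_of_nonpos ha w ?_
    by_contra hpos
    push Not at hpos
    have hpos : 0 < n := by exact_mod_cast hpos
    exact hn ⟨⟨n.toNat, by omega⟩, by simp [hpos.le]⟩
  have h := (hinj.hasSum_iff h0).mpr (hval ▸ hsum.hasSum)
  refine h.congr_fun ?_
  intro n
  simp [lipschitzKernel]

end

section

/-! ### The Bessel series -/

open Filter Topology

/-- The power series `∑ x ^ j / (j! Γ(k + j))`, which underlies both `J_{k-1}` and `I_{k-1}`. -/
def besselSeries (k x : ℝ) : ℝ := ∑' j : ℕ, x ^ j / ((j.factorial : ℝ) * Real.Gamma (k + j))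

lemma Gamma_le_Gamma_add_nat {k : ℝ} (hk : 1 ≤ k) (j : ℕ) :
    Real.Gamma k ≤ Real.Gamma (k + j) := by
  induction j with
  | zero => simp
  | succ j ih =>
    have hj : (0 : ℝ) ≤ j := j.cast_nonneg
    have h0 : 0 < Real.Gamma (k + j) := Real.Gamma_pos_of_pos (by linarith)
    push_cast
    rw [← add_assoc, Real.Gamma_add_one (by linarith)]
    nlinarith

lemma summable_besselSeries {k : ℝ} (hk : 1 ≤ k) (x : ℝ) :
    Summable (fun j : ℕ => x ^ j / ((j.factorial : ℝ) * Real.Gamma (k + j))) := by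
  have hG : 0 < Real.Gamma k := Real.Gamma_pos_of_pos (by linarith)
  refine Summable.of_norm_bounded ((Real.summable_pow_div_factorial |x|).div_const (Real.Gamma k))
    fun j => ?_
  have := Gamma_le_Gamma_add_nat hk j
  have h0 : 0 < Real.Gamma (k + j) := hG.trans_le this
  rw [norm_div, norm_pow, Real.norm_eq_abs, Real.norm_of_nonneg (by positivity), div_div]
  gcongr

/-- All coefficients are positive, so a value at a positive argument dominates every smaller
modulus. This gives bounds uniform in the modulus of the Kloosterman sum. -/
lemma abs_besselSeries_le {k : ℝ} (hk : 1 ≤ k) {x y : ℝ} (h : |x| ≤ y) :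
    |besselSeries k x| ≤ besselSeries k y := by
  have hG : ∀ j : ℕ, 0 < Real.Gamma (k + j) := fun j =>
    Real.Gamma_pos_of_pos (by have : (0 : ℝ) ≤ j := j.cast_nonneg
                              linarith)
  rw [← Real.norm_eq_abs]
  refine tsum_of_norm_bounded (summable_besselSeries hk y).hasSum fun j => ?_
  have := hG j
  rw [norm_div, norm_pow, Real.norm_eq_abs, Real.norm_of_nonneg (by positivity)]
  gcongr

/-! ### The double series behind the Bessel functions -/

lemma im_le_norm_add_int (w : ℂ) (n : ℤ) : w.im ≤ ‖w + n‖ := by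
  have := Complex.abs_im_le_norm (w + n)
  rw [Complex.add_im, Complex.intCast_im, add_zero] at this
  exact (le_abs_self _).trans this

lemma add_int_ne_zero {w : ℂ} (hw : 0 < w.im) (n : ℤ) : w + n ≠ 0 :=
  norm_pos_iff.mp (hw.trans_le (im_le_norm_add_int w n))

lemma norm_add_int_rpow_le {w : ℂ} (hw : 0 < w.im) (k : ℝ) (j : ℕ) (n : ℤ) :
    ‖w + n‖ ^ (-(k + j)) ≤ (w.im⁻¹) ^ j * ‖w + n‖ ^ (-k) := by
  have h := im_le_norm_add_int w n
  have h0 := hw.trans_le h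
  rw [neg_add, Real.rpow_add h0, mul_comm, Real.rpow_neg h0.le, Real.rpow_natCast, inv_pow]
  gcongr

lemma norm_nat_rpow_mul_e (a : ℝ) (n : ℕ+) (w : ℂ) :
    ‖((((n : ℕ) : ℝ) ^ (a - 1) : ℝ) : ℂ) * e (((n : ℕ) : ℂ) * w)‖ =
      ((n : ℕ) : ℝ) ^ (a - 1) * Real.exp (-(2 * Real.pi * (((n : ℕ) : ℝ) * w.im))) := by
  rw [norm_mul, Complex.norm_real, Real.norm_of_nonneg (by positivity), norm_e]
  congr 4
  simp

/-- Apply Lipschitz's formula at `w = iy`, where the left side is a series of positive reals, and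
take absolute values on the right. Applied with `a = k + j`, it supplies the factor `Γ(k+j)` that
cancels the one in the Bessel coefficients. -/
lemma tsum_nat_rpow_mul_exp_le {a : ℝ} (ha : 1 < a) {y : ℝ} (hy : 0 < y) :
    ∑' n : ℕ+, ((n : ℕ) : ℝ) ^ (a - 1) * Real.exp (-(2 * Real.pi * (((n : ℕ) : ℝ) * y))) ≤
      Real.Gamma a * (2 * Real.pi) ^ (-a) * ∑' n : ℤ, ‖(y : ℂ) * Complex.I + n‖ ^ (-a) := by
  have hw : 0 < ((y : ℂ) * Complex.I).im := by simpa using hy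
  have h := (hasSum_lipschitz ha hw).tsum_eq
  have h1 : ∀ n : ℕ+, ((((n : ℕ) : ℝ) ^ (a - 1) : ℝ) : ℂ) *
      e (((n : ℕ) : ℂ) * ((y : ℂ) * Complex.I)) =
      ((((n : ℕ) : ℝ) ^ (a - 1) * Real.exp (-(2 * Real.pi * (((n : ℕ) : ℝ) * y))) : ℝ) : ℂ) := by
    intro n
    rw [e]
    push_cast
    congr 2
    linear_combination (2 * Real.pi * n * y : ℂ) * Complex.I_sq
  simp_rw [h1] at h
  rw [← Complex.ofReal_tsum] at h
  have hG : 0 < Real.Gamma a := Real.Gamma_pos_of_pos (by linarith)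
  have hI : ‖Complex.I ^ (a : ℂ)‖ = 1 := by
    rw [Complex.norm_cpow_real, Complex.norm_I, Real.one_rpow]
  calc _ ≤ ‖((∑' n : ℕ+, ((n : ℕ) : ℝ) ^ (a - 1) *
      Real.exp (-(2 * Real.pi * (((n : ℕ) : ℝ) * y))) : ℝ) : ℂ)‖ := by
        rw [Complex.norm_real]; exact le_abs_self _
    _ ≤ _ := by
        rw [h, norm_mul, norm_mul, norm_mul, hI, mul_one, Complex.Gamma_ofReal, Complex.norm_real,
          Complex.norm_real, Real.norm_of_nonneg hG.le, Real.norm_of_nonneg (by positivity)]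
        gcongr
        refine tsum_of_norm_bounded (summable_norm_add_int_rpow _ ha).hasSum fun n => ?_
        rw [norm_cpow_neg_ofReal]

/-- The constant `(-2πi) ^ k = (2π) ^ k i ^ (-k)`. -/
def lipschitzConst (k : ℝ) : ℂ := (((2 * Real.pi) ^ k : ℝ) : ℂ) * Complex.I ^ (-(k : ℂ))

lemma norm_lipschitzConst (k : ℝ) : ‖lipschitzConst k‖ = (2 * Real.pi) ^ k := by
  rw [lipschitzConst, norm_mul, norm_cpow_neg_ofReal, Complex.norm_I, Real.one_rpow, mul_one,
    Complex.norm_real, Real.norm_of_nonneg (by positivity)]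

/-- The terms of the double series for `∑ (w + n) ^ (-k) e(-t / (w + n))`, summed over `n` first. -/
def besselTerm (k t : ℝ) (w : ℂ) (p : ℕ × ℕ+) : ℂ :=
  lipschitzConst k * ((((p.2 : ℕ) : ℝ) ^ (k - 1) : ℝ) : ℂ) *
    (((-(4 * Real.pi ^ 2 * t * (p.2 : ℕ))) ^ p.1 /
      ((p.1.factorial : ℝ) * Real.Gamma (k + p.1)) : ℝ) : ℂ) * e (((p.2 : ℕ) : ℂ) * w)

/-- The factor `n ^ j` is absorbed into `n ^ (k - 1)`, so that Lipschitz's formula with exponent `k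
+ j` applies to each power separately. -/
lemma besselTerm_eq (k t : ℝ) (w : ℂ) (j : ℕ) (n : ℕ+) :
    besselTerm k t w (j, n) =
      lipschitzConst k * (((-(4 * Real.pi ^ 2 * t)) ^ j /
        ((j.factorial : ℝ) * Real.Gamma (k + j)) : ℝ) : ℂ) *
      (((((n : ℕ) : ℝ) ^ ((k + j) - 1) : ℝ) : ℂ) * e (((n : ℕ) : ℂ) * w)) := by
  have hn : (0 : ℝ) < ((n : ℕ) : ℝ) := by exact_mod_cast n.pos
  have h : ((n : ℕ) : ℝ) ^ ((k + j) - 1) = ((n : ℕ) : ℝ) ^ (k - 1) * ((n : ℕ) : ℝ) ^ j := by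
    rw [← Real.rpow_natCast, ← Real.rpow_add hn]
    congr 1
    ring
  rw [besselTerm, h, ← neg_mul, mul_pow]
  push_cast
  ring

lemma lipschitzConst_mul (k : ℝ) (j : ℕ) :
    lipschitzConst k * ((((2 * Real.pi) ^ (-(k + j)) : ℝ) : ℂ) * Complex.I ^ ((k + j : ℝ) : ℂ)) =
      (Complex.I / (2 * Real.pi)) ^ j := by
  have h1 : (2 * Real.pi) ^ k * (2 * Real.pi) ^ (-(k + j)) = ((2 * Real.pi) ^ j)⁻¹ := by
    rw [← Real.rpow_add (by positivity), ← Real.rpow_natCast, ← Real.rpow_neg (by positivity)]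
    congr 1
    ring
  have h2 : Complex.I ^ (-(k : ℂ)) * Complex.I ^ ((k + j : ℝ) : ℂ) = Complex.I ^ j := by
    rw [← Complex.cpow_add _ _ Complex.I_ne_zero, ← Complex.cpow_natCast]
    congr 1
    push_cast
    ring
  rw [lipschitzConst, mul_mul_mul_comm, h2, ← Complex.ofReal_mul, h1]
  push_cast
  rw [div_pow]
  field_simp

/-- The terms of the double series for `∑ (w + n) ^ (-k) e(-t / (w + n))`. -/
def latticeTerm (k t : ℝ) (w : ℂ) (p : ℕ × ℤ) : ℂ :=
  (-(2 * Real.pi * t * Complex.I)) ^ p.1 / (p.1.factorial : ℂ) *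
    (w + p.2) ^ (-((k + p.1 : ℝ) : ℂ))

/-- In Lipschitz's formula for `k + j` the Gamma factors cancel, and `-4π²t` times `i/(2π)` is
`-2πit`, the Taylor variable of `e(-t/(w+n))`. -/
lemma hasSum_besselTerm_right {k : ℝ} (hk : 1 < k) (t : ℝ) {w : ℂ} (hw : 0 < w.im) (j : ℕ) :
    HasSum (fun n : ℕ+ => besselTerm k t w (j, n)) (∑' n : ℤ, latticeTerm k t w (j, n)) := by
  have hj : (0 : ℝ) ≤ j := j.cast_nonneg
  have hG : (Real.Gamma (k + j) : ℂ) ≠ 0 := by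
    exact_mod_cast (Real.Gamma_pos_of_pos (by linarith)).ne'
  have hf : (j.factorial : ℂ) ≠ 0 := by exact_mod_cast j.factorial_ne_zero
  simp_rw [besselTerm_eq, latticeTerm, tsum_mul_left]
  have h := (hasSum_lipschitz (a := k + j) (by linarith) hw).mul_left
    (lipschitzConst k * (((-(4 * Real.pi ^ 2 * t)) ^ j /
        ((j.factorial : ℝ) * Real.Gamma (k + j)) : ℝ) : ℂ))
  refine (congrArg (HasSum _) ?_).mp h
  rw [← mul_assoc, Complex.Gamma_ofReal]
  congr 1
  rw [show ∀ A B C D E : ℂ, A * B * (C * D * E) = (A * (D * E)) * (B * C) by intros; ring,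
    lipschitzConst_mul k j]
  push_cast
  rw [div_pow]
  field_simp
  rw [← mul_pow, ← mul_pow]
  congr 1
  ring

lemma norm_latticeTerm_le {k : ℝ} (t : ℝ) {w : ℂ} (hw : 0 < w.im) (j : ℕ) (n : ℤ) :
    ‖latticeTerm k t w (j, n)‖ ≤
      (2 * Real.pi * |t| * w.im⁻¹) ^ j / (j.factorial : ℝ) * ‖w + n‖ ^ (-k) := by
  rw [latticeTerm, norm_mul, norm_div, norm_pow, norm_cpow_neg_ofReal, Complex.norm_natCast,
    mul_pow, norm_neg]
  have h1 : ‖(2 * Real.pi * t * Complex.I : ℂ)‖ = 2 * Real.pi * |t| := by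
    simp [abs_of_pos Real.pi_pos]
  have h2 := norm_add_int_rpow_le hw k j n
  rw [h1]
  calc _ ≤ (2 * Real.pi * |t|) ^ j / (j.factorial : ℝ) * (w.im⁻¹ ^ j * ‖w + n‖ ^ (-k)) := by
        gcongr
    _ = _ := by ring

lemma summable_latticeTerm {k : ℝ} (hk : 1 < k) (t : ℝ) {w : ℂ} (hw : 0 < w.im) :
    Summable (latticeTerm k t w) := by
  have h := (Real.summable_pow_div_factorial (2 * Real.pi * |t| * w.im⁻¹)).mul_of_nonneg
    (summable_norm_add_int_rpow w hk) (fun j => by positivity) (fun n => by positivity)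
  exact Summable.of_norm_bounded h fun p => norm_latticeTerm_le t hw p.1 p.2

lemma hasSum_latticeTerm_left (k t : ℝ) {w : ℂ} (hw : 0 < w.im) (n : ℤ) :
    HasSum (fun j : ℕ => latticeTerm k t w (j, n))
      ((w + n) ^ (-(k : ℂ)) * e (-(t : ℂ) / (w + n))) := by
  have h0 := add_int_ne_zero hw n
  have h := NormedSpace.expSeries_div_hasSum_exp
    (2 * Real.pi * Complex.I * (-(t : ℂ) / (w + n)))
  rw [← Complex.exp_eq_exp_ℂ] at h
  refine (h.mul_left ((w + n) ^ (-(k : ℂ)))).congr_fun fun j => ?_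
  have hp : (w + n) ^ (-((k + j : ℝ) : ℂ)) = (w + n) ^ (-(k : ℂ)) * ((w + n) ^ j)⁻¹ := by
    rw [← Complex.cpow_natCast, ← Complex.cpow_neg, ← Complex.cpow_add _ _ h0]
    congr 1
    push_cast
    ring
  rw [latticeTerm, hp,
    show 2 * Real.pi * Complex.I * (-(t : ℂ) / (w + n)) =
      -(2 * Real.pi * t * Complex.I) * (w + n)⁻¹ by ring, mul_pow, inv_pow]
  ring

/-- The sum of norms over `n` is a Lipschitz sum at height `Im w`. Its `Γ(k+j)` cancels the
denominator, and each extra power of `|w+n|` costs at most `1/Im w`, which leaves an exponential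
series in `j`. -/
lemma summable_besselTerm {k : ℝ} (hk : 1 < k) (t : ℝ) {w : ℂ} (hw : 0 < w.im) :
    Summable (besselTerm k t w) := by
  have hnorm : ∀ (j : ℕ) (n : ℕ+), ‖besselTerm k t w (j, n)‖ =
      (2 * Real.pi) ^ k * ((4 * Real.pi ^ 2 * |t|) ^ j /
        ((j.factorial : ℝ) * Real.Gamma (k + j))) *
      (((n : ℕ) : ℝ) ^ ((k + j) - 1) * Real.exp (-(2 * Real.pi * (((n : ℕ) : ℝ) * w.im)))) := by
    intro j n
    have hj : (0 : ℝ) ≤ j := j.cast_nonneg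
    have hG := Real.Gamma_pos_of_pos (by linarith : 0 < k + j)
    rw [besselTerm_eq, norm_mul, norm_nat_rpow_mul_e, norm_mul, norm_lipschitzConst,
      Complex.norm_real, norm_div, norm_pow, norm_neg, Real.norm_eq_abs, abs_mul,
      abs_of_nonneg (by positivity : (0 : ℝ) ≤ 4 * Real.pi ^ 2),
      Real.norm_of_nonneg (by positivity : (0 : ℝ) ≤ (j.factorial : ℝ) * Real.Gamma (k + j))]
  refine Summable.of_norm ?_
  rw [summable_prod_of_nonneg (fun p => norm_nonneg _)]
  refine ⟨fun j => (hasSum_besselTerm_right hk t hw j).summable.norm, ?_⟩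
  have hSb := (Real.summable_pow_div_factorial (2 * Real.pi * |t| * w.im⁻¹)).mul_right
    (∑' n : ℤ, ‖(w.im : ℂ) * Complex.I + n‖ ^ (-k))
  refine Summable.of_nonneg_of_le (fun j => tsum_nonneg fun n => norm_nonneg _) (fun j => ?_) hSb
  have hj : (0 : ℝ) ≤ j := j.cast_nonneg
  have hG := Real.Gamma_pos_of_pos (by linarith : 0 < k + j)
  have hwI : 0 < ((w.im : ℂ) * Complex.I).im := by simpa using hw
  have hs1 := summable_norm_add_int_rpow ((w.im : ℂ) * Complex.I) hk
  have hle : ∑' n : ℤ, ‖(w.im : ℂ) * Complex.I + n‖ ^ (-(k + j)) ≤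
      w.im⁻¹ ^ j * ∑' n : ℤ, ‖(w.im : ℂ) * Complex.I + n‖ ^ (-k) := by
    rw [← tsum_mul_left]
    refine (summable_norm_add_int_rpow _ (by linarith)).tsum_le_tsum (fun n => ?_)
      (hs1.mul_left _)
    simpa using norm_add_int_rpow_le hwI k j n
  have hpi : (2 * Real.pi) ^ k * (2 * Real.pi) ^ (-(k + j)) = ((2 * Real.pi) ^ j)⁻¹ := by
    rw [← Real.rpow_add (by positivity), ← Real.rpow_natCast, ← Real.rpow_neg (by positivity)]
    congr 1
    ring
  simp_rw [hnorm, tsum_mul_left]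
  calc _ ≤ (2 * Real.pi) ^ k * ((4 * Real.pi ^ 2 * |t|) ^ j /
        ((j.factorial : ℝ) * Real.Gamma (k + j))) *
        (Real.Gamma (k + j) * (2 * Real.pi) ^ (-(k + j)) *
          (w.im⁻¹ ^ j * ∑' n : ℤ, ‖(w.im : ℂ) * Complex.I + n‖ ^ (-k))) := by
        gcongr
        refine (tsum_nat_rpow_mul_exp_le (by linarith) hw).trans ?_
        gcongr
    _ = ((2 * Real.pi) ^ k * (2 * Real.pi) ^ (-(k + j))) * (4 * Real.pi ^ 2 * |t|) ^ j *
        (Real.Gamma (k + j) / Real.Gamma (k + j)) * w.im⁻¹ ^ j / (j.factorial : ℝ) *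
          ∑' n : ℤ, ‖(w.im : ℂ) * Complex.I + n‖ ^ (-k) := by
        ring
    _ = _ := by
        rw [hpi, div_self hG.ne', show 4 * Real.pi ^ 2 * |t| = (2 * Real.pi) * (2 * Real.pi * |t|)
          by ring, mul_pow (2 * Real.pi), inv_mul_cancel_left₀ (by positivity), mul_one, ← mul_pow]

/-- The Fourier expansion of `∑ (w + n) ^ (-k) e(-t / (w + n))`. -/
lemma hasSum_besselSeries_mul_e {k : ℝ} (hk : 1 < k) (t : ℝ) {w : ℂ} (hw : 0 < w.im) :
    HasSum (fun n : ℕ+ => lipschitzConst k * ((((n : ℕ) : ℝ) ^ (k - 1) : ℝ) : ℂ) *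
        (besselSeries k (-(4 * Real.pi ^ 2 * t * (n : ℕ))) : ℂ) * e (((n : ℕ) : ℂ) * w))
      (∑' n : ℤ, (w + n) ^ (-(k : ℂ)) * e (-(t : ℂ) / (w + n))) := by
  have hb := summable_besselTerm hk t hw
  have hl := summable_latticeTerm hk t hw
  -- For each `j` the two double series have the same inner sum by Lipschitz's formula, so their
  -- totals agree. Fubini in the other order then gives the sum over `n` on either side.
  have h1 : HasSum (fun j : ℕ => ∑' n : ℤ, latticeTerm k t w (j, n)) (∑' p, besselTerm k t w p) :=
    hb.hasSum.prod_fiberwise fun j => hasSum_besselTerm_right hk t hw j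
  have h2 : HasSum (fun j : ℕ => ∑' n : ℤ, latticeTerm k t w (j, n)) (∑' p, latticeTerm k t w p) :=
    hl.hasSum.prod_fiberwise fun j => (hl.prod_factor j).hasSum
  have h3 : HasSum (fun n : ℤ => (w + n) ^ (-(k : ℂ)) * e (-(t : ℂ) / (w + n)))
      (∑' p, latticeTerm k t w p) :=
    ((Equiv.prodComm ℤ ℕ).hasSum_iff.mpr hl.hasSum).prod_fiberwise
      fun n => hasSum_latticeTerm_left k t hw n
  rw [h3.tsum_eq, ← h1.unique h2]
  refine ((Equiv.prodComm ℕ+ ℕ).hasSum_iff.mpr hb.hasSum).prod_fiberwise fun n => ?_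
  have h := (Complex.hasSum_ofReal.mpr
    (summable_besselSeries hk.le (-(4 * Real.pi ^ 2 * t * (n : ℕ)))).hasSum)
  exact (h.mul_left (lipschitzConst k * ((((n : ℕ) : ℝ) ^ (k - 1) : ℝ) : ℂ))).mul_right
    (e (((n : ℕ) : ℂ) * w))

/-- Use the expansion at `-t`, where the Bessel series has nonnegative arguments: its absolute
convergence is the claim up to the factor `(2π)^k`. -/
lemma summable_rpow_mul_besselSeries_mul_exp {k : ℝ} (hk : 1 < k) {t : ℝ} (ht : 0 ≤ t) {y : ℝ}
    (hy : 0 < y) :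
    Summable (fun n : ℕ+ => ((n : ℕ) : ℝ) ^ (k - 1) *
      besselSeries k (4 * Real.pi ^ 2 * t * (n : ℕ)) *
        Real.exp (-(2 * Real.pi * (((n : ℕ) : ℝ) * y)))) := by
  have hw : 0 < ((y : ℂ) * Complex.I).im := by simpa using hy
  have h := (hasSum_besselSeries_mul_e hk (-t) hw).summable.norm.mul_left ((2 * Real.pi) ^ k)⁻¹
  refine h.congr fun n => ?_
  have h0 : 0 ≤ besselSeries k (4 * Real.pi ^ 2 * t * (n : ℕ)) :=
    (abs_nonneg _).trans (abs_besselSeries_le hk.le (abs_of_nonneg (by positivity)).le)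
  have him : (((n : ℕ) : ℂ) * ((y : ℂ) * Complex.I)).im = ((n : ℕ) : ℝ) * y := by simp
  rw [norm_mul, norm_mul, norm_mul, norm_lipschitzConst, norm_e, Complex.norm_real,
    Complex.norm_real, Real.norm_of_nonneg (by positivity),
    show -(4 * Real.pi ^ 2 * -t * (n : ℕ)) = 4 * Real.pi ^ 2 * t * (n : ℕ) by ring,
    Real.norm_of_nonneg h0, him]
  field_simp

end

section

/-! ### The coefficients -/

lemma besselSeries_zero (k : ℝ) : besselSeries k 0 = (Real.Gamma k)⁻¹ := by
  rw [besselSeries, tsum_eq_single 0]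
  · simp
  · intro j hj
    simp [hj]

/-- The sign `s = -1` serves `J`, and `s = 1` serves `I`. -/
lemma bessel_term_eq (k : ℝ) {x : ℝ} (hx : 0 < x) (j : ℕ) (s : ℝ) :
    (s : ℂ) ^ j / ((j.factorial : ℂ) * Complex.Gamma (((k : ℂ) - 1) + j + 1)) *
      ((x / 2 : ℝ) : ℂ) ^ (((k : ℂ) - 1) + 2 * j) =
    (((x / 2) ^ (k - 1) : ℝ) : ℂ) * (((s * (x ^ 2 / 4)) ^ j /
      ((j.factorial : ℝ) * Real.Gamma (k + j)) : ℝ) : ℂ) := by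
  have hx2 : ((x / 2 : ℝ) : ℂ) ≠ 0 := by exact_mod_cast (by positivity : x / 2 ≠ 0)
  have h1 : ((x / 2 : ℝ) : ℂ) ^ (((k : ℂ) - 1) + 2 * j) =
      (((x / 2) ^ (k - 1) : ℝ) : ℂ) * ((x / 2 : ℝ) : ℂ) ^ (2 * j) := by
    rw [Complex.cpow_add _ _ hx2, Complex.ofReal_cpow (by positivity), ← Complex.cpow_natCast]
    push_cast
    rfl
  have h2 : Complex.Gamma (((k : ℂ) - 1) + j + 1) = (Real.Gamma (k + j) : ℂ) := by
    rw [← Complex.Gamma_ofReal]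
    congr 1
    push_cast
    ring
  rw [h1, h2, pow_mul, show x ^ 2 / 4 = (x / 2) ^ 2 by ring, mul_pow]
  push_cast
  ring

lemma besselJ_eq (k : ℝ) {x : ℝ} (hx : 0 < x) :
    besselJ ((k : ℂ) - 1) x = (((x / 2) ^ (k - 1) * besselSeries k (-(x ^ 2 / 4)) : ℝ) : ℂ) := by
  rw [besselJ, besselSeries, Complex.ofReal_mul, Complex.ofReal_tsum, ← tsum_mul_left]
  refine tsum_congr fun j => ?_
  have := bessel_term_eq k hx j (-1)
  rw [neg_one_mul] at this
  rw [← this]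
  simp

lemma besselI_eq (k : ℝ) {x : ℝ} (hx : 0 < x) :
    besselI ((k : ℂ) - 1) x = (((x / 2) ^ (k - 1) * besselSeries k (x ^ 2 / 4) : ℝ) : ℂ) := by
  rw [besselI, besselSeries, Complex.ofReal_mul, Complex.ofReal_tsum, ← tsum_mul_left]
  refine tsum_congr fun j => ?_
  have := bessel_term_eq k hx j 1
  rw [one_mul] at this
  rw [← this]
  simp

/-- The powers of `P` cancel: what remains does not depend on `m` and `n`, and it is the same in the
`J` and `I` cases. -/
lemma bessel_prefactor {k P M : ℝ} (hP : 0 < P) (hM : 0 < M) :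
    P ^ ((1 - k) / 2) * (4 * Real.pi * √P / M / 2) ^ (k - 1) / M =
      (2 * Real.pi) ^ (k - 1) * M ^ (-k) := by
  have h1 : √P ^ (k - 1) = P ^ ((k - 1) / 2) := by
    rw [Real.sqrt_eq_rpow, ← Real.rpow_mul hP.le]
    congr 1
    ring
  have h2 : P ^ ((1 - k) / 2) * P ^ ((k - 1) / 2) = 1 := by
    rw [← Real.rpow_add hP, show (1 - k) / 2 + (k - 1) / 2 = 0 by ring, Real.rpow_zero]
  have h3 : M⁻¹ ^ (k - 1) * M⁻¹ = M ^ (-k) := by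
    rw [← Real.rpow_add_one (inv_pos.mpr hM).ne', sub_add_cancel, Real.inv_rpow hM.le,
      Real.rpow_neg hM.le]
  rw [show 4 * Real.pi * √P / M / 2 = (2 * Real.pi) * √P * M⁻¹ by ring,
    Real.mul_rpow (by positivity) (by positivity), Real.mul_rpow (by positivity) (by positivity),
    h1, ← h3, div_eq_mul_inv]
  linear_combination ((2 * Real.pi) ^ (k - 1) * M⁻¹ ^ (k - 1) * M⁻¹) * h2

/-- At `s = k / 2` all cases of the coefficient kernel are values of `besselSeries`. -/
lemma coeffKernel_div (κ m : ℤ) (n : ℕ+) {M : ℕ} (hM : 0 < M) (hk : 0 < wt κ) :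
    coeffKernel κ m ((n : ℕ) : ℤ) ((wt κ : ℂ) / 2) M / (M : ℂ) =
      delta κ m * (((2 * Real.pi) ^ (wt κ - 1) * (M : ℝ) ^ (-wt κ) : ℝ) : ℂ) *
        (besselSeries (wt κ) (-(4 * Real.pi ^ 2 * ((m : ℝ) / (M : ℝ) ^ 2) * (n : ℕ))) : ℂ) := by
  have hMr : (0 : ℝ) < (M : ℝ) := by exact_mod_cast hM
  have hMc : (M : ℂ) ≠ 0 := by exact_mod_cast hM.ne'
  have hnz : (0 : ℤ) < ((n : ℕ) : ℤ) := by exact_mod_cast n.pos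
  have hs : 2 * ((wt κ : ℂ) / 2) = wt κ := by ring
  have hsq : ∀ P : ℝ, 0 ≤ P → (4 * Real.pi * √P / M) ^ 2 / 4 = 4 * Real.pi ^ 2 * P / M ^ 2 := by
    intro P hP
    rw [div_pow, mul_pow, Real.sq_sqrt hP]
    ring
  rcases lt_trichotomy m 0 with h | h | h
  · have hneg : m * ((n : ℕ) : ℤ) < 0 := mul_neg_of_neg_of_pos h hnz
    have hr : (m : ℝ) * (((n : ℕ) : ℤ) : ℝ) < 0 := by exact_mod_cast hneg
    have hP : 0 < |(m : ℝ) * (((n : ℕ) : ℤ) : ℝ)| := abs_pos.mpr hr.ne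
    rw [coeffKernel, if_neg hneg.not_gt, if_pos hneg, hs, besselI_eq _ (by positivity),
      hsq _ hP.le, delta, if_neg h.ne, one_mul, ← bessel_prefactor hP hMr, abs_of_neg hr]
    push_cast
    rw [show 4 * Real.pi ^ 2 * -((m : ℝ) * ((n : ℕ) : ℝ)) / (M : ℝ) ^ 2 =
      -(4 * Real.pi ^ 2 * ((m : ℝ) / (M : ℝ) ^ 2) * ((n : ℕ) : ℝ)) by ring]
    ring
  -- For `m = 0` the series is evaluated at `0`, where it equals `1/Γ(k)`; the factor `δ_0 = Γ(k)`
  -- compensates.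
  · subst h
    rw [coeffKernel, if_neg (by simp), if_neg (by simp), if_pos (by simp), delta, if_pos rfl,
      show (wt κ : ℂ) / 2 + (wt κ : ℂ) / 2 - 1 = ((wt κ - 1 : ℝ) : ℂ) by push_cast; ring,
      sub_self, Complex.cpow_zero, hs, Int.cast_zero, zero_div, mul_zero, zero_mul, neg_zero,
      besselSeries_zero, Complex.Gamma_ofReal,
      show 1 - (wt κ : ℂ) = ((-wt κ : ℝ) : ℂ) + 1 by push_cast; ring, Complex.cpow_add _ _ hMc,
      Complex.cpow_one, show (wt κ : ℂ) - 1 = ((wt κ - 1 : ℝ) : ℂ) by push_cast; ring,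
      Real.mul_rpow (by norm_num) Real.pi_pos.le]
    have hG : (Real.Gamma (wt κ) : ℂ) ≠ 0 := by
      exact_mod_cast (Real.Gamma_pos_of_pos hk).ne'
    rw [Complex.ofReal_mul, Complex.ofReal_mul, Complex.ofReal_cpow (by norm_num),
      Complex.ofReal_cpow Real.pi_pos.le, Complex.ofReal_cpow hMr.le]
    push_cast
    field_simp
  · have hpos : 0 < m * ((n : ℕ) : ℤ) := mul_pos h hnz
    have hr : 0 < (m : ℝ) * (((n : ℕ) : ℤ) : ℝ) := by exact_mod_cast hpos
    have hP : 0 < |(m : ℝ) * (((n : ℕ) : ℤ) : ℝ)| := abs_pos.mpr hr.ne'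
    rw [coeffKernel, if_pos hpos, hs, besselJ_eq _ (by positivity),
      hsq _ hP.le, delta, if_neg h.ne', one_mul, ← bessel_prefactor hP hMr, abs_of_pos hr]
    push_cast
    rw [show 4 * Real.pi ^ 2 * ((m : ℝ) * ((n : ℕ) : ℝ)) / (M : ℝ) ^ 2 =
      (4 * Real.pi ^ 2 * ((m : ℝ) / (M : ℝ) ^ 2) * ((n : ℕ) : ℝ)) by ring]
    ring

lemma norm_e_ofReal (x : ℝ) : ‖e x‖ = 1 := by
  simp [norm_e]

lemma kloosterman_eq (κ m n : ℤ) (c : ℕ) :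
    kloosterman κ m n c = ∑ v ∈ (Finset.range c).filter (fun v => Nat.Coprime v c),
      multiplier κ c v *
        e (((m : ℂ) * ((((v : ZMod c)⁻¹).val : ℕ) : ℂ) + (n : ℂ) * (v : ℂ)) / (c : ℂ)) := rfl

/-- The trivial bound suffices: with the kernel's decay it leaves `c ^ (1 - k)`, summable because `k
> 2`. -/
lemma norm_kloosterman_le (κ m n : ℤ) (c : ℕ) : ‖kloosterman κ m n c‖ ≤ c := by
  rw [kloosterman_eq]
  have h : ∀ v ∈ (Finset.range c).filter (fun v => Nat.Coprime v c), ‖multiplier κ c v *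
      e (((m : ℂ) * ((((v : ZMod c)⁻¹).val : ℕ) : ℂ) + (n : ℂ) * (v : ℂ)) / (c : ℂ))‖ ≤ 1 := by
    intro v _
    have := norm_e_ofReal (((m : ℝ) * ((((v : ZMod c)⁻¹).val : ℕ) : ℝ) + (n : ℝ) * (v : ℝ)) / c)
    push_cast at this
    rw [norm_mul, this, mul_one]
    exact norm_multiplier_le _ _ _
  refine (norm_sum_le_of_le _ h).trans ?_
  rw [Finset.sum_const, nsmul_one]
  exact_mod_cast (Finset.card_filter_le _ _).trans (Finset.card_range c).le

lemma summable_mul_rpow {N : ℕ} (hN : 0 < N) {k : ℝ} (hk : 2 < k) :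
    Summable (fun c : ℕ+ => ((N * (c : ℕ) : ℕ) : ℝ) ^ (1 - k)) := by
  have h := (Real.summable_nat_rpow (p := 1 - k)).mpr (by linarith)
  refine h.comp_injective (i := fun c : ℕ+ => N * (c : ℕ)) fun a b hab => ?_
  exact PNat.eq (Nat.eq_of_mul_eq_mul_left hN hab)

/-- As `M ≥ 1`, the Bessel argument is largest in modulus at `M = 1`. The bound is a function of `c`
times a function of `n`, which is what makes the double series over `(c, n)` converge. -/
lemma norm_coeffTerm_le (κ m : ℤ) {N : ℕ} (hN : 0 < N) (n : ℕ+) (hk : 2 < wt κ) (c : ℕ+) :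
    ‖coeffTerm κ m N ((n : ℕ) : ℤ) ((wt κ : ℂ) / 2) c‖ ≤
      ‖delta κ m‖ * (2 * Real.pi) ^ (wt κ - 1) * ((N * (c : ℕ) : ℕ) : ℝ) ^ (1 - wt κ) *
        besselSeries (wt κ) (4 * Real.pi ^ 2 * |(m : ℝ)| * (n : ℕ)) := by
  have hM : 0 < N * (c : ℕ) := Nat.mul_pos hN c.pos
  set M := N * (c : ℕ) with hMdef
  have hMr : (1 : ℝ) ≤ (M : ℝ) := by exact_mod_cast hM
  have hM0 : (0 : ℝ) < (M : ℝ) := by linarith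
  have hb : |besselSeries (wt κ) (-(4 * Real.pi ^ 2 * ((m : ℝ) / (M : ℝ) ^ 2) * (n : ℕ)))| ≤
      besselSeries (wt κ) (4 * Real.pi ^ 2 * |(m : ℝ)| * (n : ℕ)) := by
    refine abs_besselSeries_le (by linarith) ?_
    rw [abs_neg, abs_mul, abs_mul, abs_div, abs_of_nonneg (by positivity : 0 ≤ 4 * Real.pi ^ 2),
      abs_of_nonneg (by positivity : 0 ≤ (M : ℝ) ^ 2), Nat.abs_cast]
    gcongr
    exact div_le_self (abs_nonneg _) (by nlinarith)
  rw [coeffTerm, div_mul_eq_mul_div, mul_div_assoc, coeffKernel_div κ m n hM (by linarith),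
    norm_mul, norm_mul, norm_mul, Complex.norm_real, Complex.norm_real,
    Real.norm_of_nonneg (by positivity), Real.norm_eq_abs]
  have hpow : (M : ℝ) ^ (1 - wt κ) = (M : ℝ) * (M : ℝ) ^ (-wt κ) := by
    rw [sub_eq_add_neg, Real.rpow_add hM0, Real.rpow_one]
  calc _ ≤ (M : ℝ) * (‖delta κ m‖ * ((2 * Real.pi) ^ (wt κ - 1) * (M : ℝ) ^ (-wt κ)) *
        besselSeries (wt κ) (4 * Real.pi ^ 2 * |(m : ℝ)| * (n : ℕ))) := by
        gcongr
        exact norm_kloosterman_le _ _ _ _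
    _ = _ := by rw [hpow]; ring

lemma summable_coeffTerm (κ m : ℤ) {N : ℕ} (hN : 0 < N) (n : ℕ+) (hk : 2 < wt κ) :
    Summable (coeffTerm κ m N ((n : ℕ) : ℤ) ((wt κ : ℂ) / 2)) :=
  Summable.of_norm_bounded (((summable_mul_rpow hN hk).mul_left _).mul_right _)
    fun c => norm_coeffTerm_le κ m hN n hk c

end

section

open Filter Topology

/-! ### Majorants for the Poincaré series -/

/-- The bottom row of `γ A`, where `γ` represents the given coset. -/
def cosetRow {N : ℕ} (A : SL(2, ℤ)) (q : Cosets N) : Fin 2 → ℤ :=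
  ((q.out : CongruenceSubgroup.Gamma0 N) * A : SL(2, ℤ)) 1

lemma mul_inv_lower_left (g h : SL(2, ℤ)) :
    (g * h⁻¹) 1 0 = g 1 0 * h 1 1 - g 1 1 * h 1 0 := by
  rw [mul_row, Matrix.SpecialLinearGroup.coe_inv, Matrix.adjugate_fin_two]
  simp
  ring

lemma mem_GammaInf_iff {N : ℕ} (γ : CongruenceSubgroup.Gamma0 N) :
    γ ∈ GammaInf N ↔ (γ : SL(2, ℤ)) 1 0 = 0 := by
  constructor
  · rintro ⟨n, hn | hn⟩
    · simp [hn, ModularGroup.coe_T_zpow]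
    · simp [hn, ModularGroup.coe_T_zpow]
  · exact eq_T_zpow_or_of_lower_left_eq_zero _

/-- The lower left entry of `γ' γ⁻¹` is the determinant of the two bottom rows, and `Γ_∞` is the
locus where that entry vanishes. -/
lemma coset_eq_iff {N : ℕ} (γ γ' : CongruenceSubgroup.Gamma0 N) :
    (Quotient.mk (QuotientGroup.rightRel (GammaInf N)) γ : Cosets N) =
      Quotient.mk (QuotientGroup.rightRel (GammaInf N)) γ' ↔
    (γ' : SL(2, ℤ)) 1 0 * (γ : SL(2, ℤ)) 1 1 = (γ' : SL(2, ℤ)) 1 1 * (γ : SL(2, ℤ)) 1 0 := by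
  rw [Quotient.eq, QuotientGroup.rightRel_apply, mem_GammaInf_iff]
  change ((γ' : SL(2, ℤ)) * (γ : SL(2, ℤ))⁻¹) 1 0 = 0 ↔ _
  rw [mul_inv_lower_left, sub_eq_zero]

lemma cosetRow_injective {N : ℕ} (A : SL(2, ℤ)) :
    Function.Injective (cosetRow (N := N) A) := by
  intro p q h
  rw [← Quotient.out_eq p, ← Quotient.out_eq q, coset_eq_iff, ← sub_eq_zero, ← mul_inv_lower_left]
  have h0 : (((q.out : CongruenceSubgroup.Gamma0 N) * A : SL(2, ℤ)) *
      ((p.out : CongruenceSubgroup.Gamma0 N) * A : SL(2, ℤ))⁻¹ : SL(2, ℤ)) 1 0 = 0 := by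
    have h1 := congrFun h 0
    have h2 := congrFun h 1
    simp only [cosetRow] at h1 h2
    rw [mul_inv_lower_left, ← h1, ← h2]
    ring
  rwa [mul_inv_rev, mul_assoc, mul_inv_cancel_left] at h0

lemma slash_phi_eq (κ m : ℤ) (hk : 0 < wt κ) (γ : SL(2, ℤ)) (z : ℍ) :
    slash κ (phi κ m ((wt κ : ℂ) / 2)) γ z =
      delta κ m / Complex.Gamma (wt κ) * (multiplier κ (γ 1 0) (γ 1 1) *
        cocycle γ z ^ (-(wt κ : ℂ)) * e ((m : ℂ) * ((γ • z : ℍ) : ℂ))) := by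
  rw [slash, phi_half_weight κ m hk, jFactor_zpow]
  ring

lemma norm_e_smul (m : ℤ) (z : ℍ) :
    ‖e ((m : ℂ) * (z : ℂ))‖ = Real.exp (-(2 * Real.pi * (m * z.im))) := by
  rw [norm_e]
  congr 4
  simp

lemma norm_slash_phi (κ m : ℤ) (hk : 0 < wt κ) (γ : SL(2, ℤ)) (z : ℍ) :
    ‖slash κ (phi κ m ((wt κ : ℂ) / 2)) γ z‖ =
      ‖delta κ m / Complex.Gamma (wt κ)‖ * (‖cocycle γ z‖ ^ (-wt κ) *
        Real.exp (-(2 * Real.pi * (m * (γ • z).im)))) := by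
  rw [slash_phi_eq κ m hk, norm_mul, norm_mul, norm_mul, norm_multiplier κ (isCoprime_row γ),
    one_mul, norm_cpow_neg_ofReal, norm_e_smul]

/-- The terms at a cusp only depend on the bottom row of `γ A`. -/
lemma norm_cocycle_mul_poincareTerm (κ m : ℤ) {N : ℕ} (hk : 0 < wt κ) (A : SL(2, ℤ)) (z : ℍ)
    (q : Cosets N) :
    ‖cocycle A z ^ (-(wt κ : ℂ)) * poincareTerm κ m N ((wt κ : ℂ) / 2) (A • z) q‖ =
      ‖delta κ m / Complex.Gamma (wt κ)‖ *
        (‖cocycle ((q.out : CongruenceSubgroup.Gamma0 N) * A) z‖ ^ (-wt κ) *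
          Real.exp (-(2 * Real.pi * (m *
            (((q.out : CongruenceSubgroup.Gamma0 N) * A : SL(2, ℤ)) • z).im)))) := by
  rw [poincareTerm, norm_mul, norm_slash_phi κ m hk, norm_cpow_neg_ofReal, cocycle_mul, norm_mul,
    Real.mul_rpow (norm_nonneg _) (norm_nonneg _), mul_smul]
  ring

lemma cocycle_mul_eq_cosetRow {N : ℕ} (A : SL(2, ℤ)) (z : ℍ) (q : Cosets N) :
    cocycle ((q.out : CongruenceSubgroup.Gamma0 N) * A) z =
      (cosetRow A q 0 : ℂ) * z + cosetRow A q 1 := rfl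

lemma im_le_norm_cocycle {γ : SL(2, ℤ)} (hc : γ 1 0 ≠ 0) (z : ℍ) : z.im ≤ ‖cocycle γ z‖ := by
  have h1 : (1 : ℝ) ≤ |((γ 1 0 : ℤ) : ℝ)| := by exact_mod_cast Int.one_le_abs hc
  have h2 := Complex.abs_im_le_norm (cocycle γ z)
  rw [im_cocycle, abs_mul, abs_of_pos z.im_pos] at h2
  nlinarith [z.im_pos]

/-- `Im γz = y / |cz+d|²`, and `|cz+d| ≥ y` when `c ≠ 0`. -/
lemma im_smul_le_inv {γ : SL(2, ℤ)} (hc : γ 1 0 ≠ 0) (z : ℍ) : (γ • z).im ≤ z.im⁻¹ := by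
  have h := im_le_norm_cocycle hc z
  have hy := z.im_pos
  rw [im_smul_eq_div_cocycle, div_le_iff₀ (by nlinarith)]
  rw [inv_mul_eq_div, le_div_iff₀ hy]
  nlinarith

lemma norm_cocycle_eq_one {γ : SL(2, ℤ)} (hc : γ 1 0 = 0) (z : ℍ) : ‖cocycle γ z‖ = 1 := by
  have hd := det_eq_one γ
  rw [hc, mul_zero, sub_zero] at hd
  rcases Int.isUnit_iff.mp (IsUnit.of_mul_eq_one_right _ hd) with h1 | h1 <;>
    simp [cocycle, hc, h1]

lemma im_smul_eq_of_lower_left {γ : SL(2, ℤ)} (hc : γ 1 0 = 0) (z : ℍ) : (γ • z).im = z.im := by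
  rw [im_smul_eq_div_cocycle, norm_cocycle_eq_one hc]
  simp

lemma im_smul_le (γ : SL(2, ℤ)) (z : ℍ) : (γ • z).im ≤ z.im + z.im⁻¹ := by
  have hy := z.im_pos
  have hy' := inv_pos.mpr hy
  rcases eq_or_ne (γ 1 0) 0 with hc | hc
  · rw [im_smul_eq_of_lower_left hc]; linarith
  · have := im_smul_le_inv hc z; linarith

lemma summable_lattice (z : ℍ) {k : ℝ} (hk : 2 < k) :
    Summable (fun x : Fin 2 → ℤ => ‖(x 0 : ℂ) * z + x 1‖ ^ (-k)) :=
  Summable.of_nonneg_of_le (fun x => by positivity)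
    (EisensteinSeries.summand_bound z (by linarith))
    ((EisensteinSeries.summable_one_div_norm_rpow hk).mul_left _)

/-- The exponential is bounded because `Im γz ≤ y + 1/y`; the rest is a lattice sum over distinct
bottom rows. -/
lemma summable_poincareTerm (κ m : ℤ) (N : ℕ) (hk : 2 < wt κ) (z : ℍ) :
    Summable (poincareTerm κ m N ((wt κ : ℂ) / 2) z) := by
  have h := (((summable_lattice z hk).comp_injective (cosetRow_injective (N := N) 1)).mul_right
    (Real.exp (2 * Real.pi * (|(m : ℝ)| * (z.im + z.im⁻¹))))).mul_left
      ‖delta κ m / Complex.Gamma (wt κ)‖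
  refine Summable.of_norm_bounded h fun q => ?_
  have hq := norm_cocycle_mul_poincareTerm κ m (N := N) (by linarith) 1 z q
  have h1 : cocycle (1 : SL(2, ℤ)) z = 1 := by simp [cocycle]
  rw [h1, Complex.one_cpow, one_mul, one_smul, cocycle_mul_eq_cosetRow] at hq
  rw [hq]
  simp only [Function.comp_apply]
  gcongr
  have h2 := im_smul_le ((q.out : CongruenceSubgroup.Gamma0 N) * 1 : SL(2, ℤ)) z
  have h3 := (((q.out : CongruenceSubgroup.Gamma0 N) * 1 : SL(2, ℤ)) • z).im_pos
  have h4 := neg_abs_le (m : ℝ)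
  have h5 := abs_nonneg (m : ℝ)
  rw [← mul_neg]
  gcongr
  nlinarith

/-- The lattice sums `∑ |c z + d| ^ (-k)` are bounded for `Im z ≥ 1`. -/
lemma exists_lattice_bound {k : ℝ} (hk : 2 < k) :
    ∃ D : ℝ, ∀ z : ℍ, 1 ≤ z.im → ∑' x : Fin 2 → ℤ, ‖(x 0 : ℂ) * z + x 1‖ ^ (-k) ≤ D := by
  refine ⟨EisensteinSeries.r ⟨⟨1, 1⟩, one_pos⟩ ^ (-k) * ∑' x : Fin 2 → ℤ, ‖x‖ ^ (-k),
    fun z hz => ?_⟩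
  -- An integer translation moves `z` into a fixed vertical strip, where the lattice majorant is
  -- uniform; the shear `E` of the lattice undoes the translation.
  set n : ℤ := ⌊z.re⌋ with hn
  set z₀ : ℍ := (-n : ℝ) +ᵥ z with hz₀
  have hstrip : z₀ ∈ verticalStrip 1 1 := by
    refine ⟨?_, by simpa [hz₀] using hz⟩
    rw [hz₀, vadd_re, abs_le]
    have h1 := Int.floor_le z.re
    have h2 := Int.lt_floor_add_one z.re
    constructor <;> linarith
  let E : (Fin 2 → ℤ) ≃ (Fin 2 → ℤ) :=
    { toFun := fun x => ![x 0, x 1 - n * x 0]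
      invFun := fun x => ![x 0, x 1 + n * x 0]
      left_inv := fun x => by ext i; fin_cases i <;> simp
      right_inv := fun x => by ext i; fin_cases i <;> simp }
  have hE : ∀ x : Fin 2 → ℤ, ‖((E x) 0 : ℂ) * z + (E x) 1‖ = ‖(x 0 : ℂ) * z₀ + x 1‖ := by
    intro x
    congr 1
    simp [E, hz₀]
    ring
  rw [← E.tsum_eq, ← tsum_mul_left]
  simp_rw [hE]
  exact (summable_lattice z₀ hk).tsum_le_tsum
    (fun x => EisensteinSeries.summand_bound_of_mem_verticalStrip (by linarith) x one_pos hstrip)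
    ((EisensteinSeries.summable_one_div_norm_rpow hk).mul_left _)

/-- The behaviour of the Poincaré series at the cusps. -/
lemma exists_atCusp_bound (κ m : ℤ) (N : ℕ) (hk : 2 < wt κ) (A : SL(2, ℤ)) :
    ∃ C : ℝ, 0 ≤ C ∧ ∀ z : ℍ, 1 ≤ z.im →
      ‖atCusp κ (poincare κ m N ((wt κ : ℂ) / 2)) A z‖ ≤
        C * (Real.exp (-(2 * Real.pi * (m * z.im))) + z.im ^ (-((wt κ - 2) / 2))) := by
  -- Split `k = (k-2)/2 + (k+2)/2`: the second exponent still exceeds `2`, so the lattice sum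
  -- converges, while the first yields decay in `y`.
  obtain ⟨D, hD⟩ := exists_lattice_bound (k := (wt κ + 2) / 2) (by linarith)
  -- The rows `(0, ±1)`, which produce the term `e^(-2πmy)`. For all other rows `Im γz ≤ 1/y ≤ 1`,
  -- so the exponential is at most `E`.
  set S : Set (Fin 2 → ℤ) := {x | x 0 = 0 ∧ |x 1| = 1} with hS
  have hSfin : S.Finite := by
    refine Set.Finite.subset (Set.Finite.insert ![0, 1] (Set.finite_singleton ![0, -1])) ?_
    rintro x ⟨h0, h1⟩
    rcases eq_or_eq_neg_of_abs_eq h1 with h1 | h1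
    · left; ext i; fin_cases i <;> simp [h0, h1]
    · right; ext i; fin_cases i <;> simp [h0, h1]
  set E : ℝ := Real.exp (2 * Real.pi * |(m : ℝ)|) with hE
  set B : ℝ := ‖delta κ m / Complex.Gamma (wt κ)‖ with hB
  set s : ℝ := ∑' x, S.indicator (fun _ => (1 : ℝ)) x with hs
  have hSsum : Summable (S.indicator (fun _ => (1 : ℝ))) :=
    summable_of_hasFiniteSupport (hSfin.subset Set.support_indicator_subset)
  have hs0 : 0 ≤ s := tsum_nonneg fun x => Set.indicator_nonneg (fun _ _ => zero_le_one) x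
  have hD0 : 0 ≤ D := (tsum_nonneg fun x => by positivity).trans (hD UpperHalfPlane.I (by simp))
  refine ⟨B * (s + E * D), by positivity, fun z hz => ?_⟩
  have hy := z.im_pos
  set X : ℝ := Real.exp (-(2 * Real.pi * (m * z.im))) with hX
  set Y : ℝ := z.im ^ (-((wt κ - 2) / 2)) with hY
  have hlat := (summable_lattice z (k := (wt κ + 2) / 2) (by linarith))
  set g : (Fin 2 → ℤ) → ℝ := fun x => B * (X * S.indicator (fun _ => (1 : ℝ)) x +
    E * Y * ‖(x 0 : ℂ) * z + x 1‖ ^ (-((wt κ + 2) / 2))) with hg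
  have hgsum : Summable g := ((hSsum.mul_left _).add (hlat.mul_left _)).mul_left _
  have hg0 : ∀ x, 0 ≤ g x := fun x => by
    have : 0 ≤ S.indicator (fun _ => (1 : ℝ)) x := Set.indicator_nonneg (fun _ _ => zero_le_one) x
    positivity
  have hterm : ∀ q : Cosets N, ‖cocycle A z ^ (-(wt κ : ℂ)) *
      poincareTerm κ m N ((wt κ : ℂ) / 2) (A • z) q‖ ≤ g (cosetRow A q) := by
    intro q
    rw [norm_cocycle_mul_poincareTerm κ m (by linarith)]
    set γ : SL(2, ℤ) := (q.out : CongruenceSubgroup.Gamma0 N) * A with hγ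
    have hrow : (cosetRow A q 0 : ℂ) * z + cosetRow A q 1 = cocycle γ z := rfl
    simp only [hg]
    rw [hrow]
    have hind : 0 ≤ S.indicator (fun _ => (1 : ℝ)) (cosetRow A q) :=
      Set.indicator_nonneg (fun _ _ => zero_le_one) _
    refine mul_le_mul_of_nonneg_left ?_ (norm_nonneg _)
    rcases eq_or_ne (γ 1 0) 0 with hc | hc
    · have hmem : cosetRow A q ∈ S := by
        refine ⟨hc, ?_⟩
        have hd := det_eq_one γ
        rw [hc, mul_zero, sub_zero] at hd
        exact Int.isUnit_iff_abs_eq.mp (IsUnit.of_mul_eq_one_right _ hd)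
      rw [Set.indicator_of_mem hmem, im_smul_eq_of_lower_left hc, norm_cocycle_eq_one hc,
        Real.one_rpow, one_mul, mul_one]
      exact le_add_of_nonneg_right (by positivity)
    · have h1 := im_le_norm_cocycle hc z
      have h2 := im_smul_le_inv hc z
      have h3 : z.im⁻¹ ≤ 1 := inv_le_one_of_one_le₀ hz
      have h4 := (γ • z).im_pos
      have h5 := neg_abs_le (m : ℝ)
      have h6 := abs_nonneg (m : ℝ)
      have hexp : Real.exp (-(2 * Real.pi * (m * (γ • z).im))) ≤ E := by
        rw [hE, ← mul_neg]
        gcongr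
        nlinarith
      have hpow : ‖cocycle γ z‖ ^ (-wt κ) ≤ Y * ‖cocycle γ z‖ ^ (-((wt κ + 2) / 2)) := by
        have : ‖cocycle γ z‖ ^ (-wt κ) = ‖cocycle γ z‖ ^ (-((wt κ - 2) / 2)) *
            ‖cocycle γ z‖ ^ (-((wt κ + 2) / 2)) := by
          rw [← Real.rpow_add (by linarith)]
          congr 1
          ring
        rw [this]
        gcongr
        exact Real.rpow_le_rpow_of_nonpos hy h1 (by linarith)
      calc _ ≤ (Y * ‖cocycle γ z‖ ^ (-((wt κ + 2) / 2))) * E := by gcongr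
        _ = 0 + E * Y * ‖cocycle γ z‖ ^ (-((wt κ + 2) / 2)) := by ring
        _ ≤ _ := by gcongr; positivity
  have hgc := hgsum.comp_injective (cosetRow_injective (N := N) A)
  rw [atCusp, poincare, ← tsum_mul_left]
  -- Distinct cosets have distinct rows, so the sum may be enlarged to all integer pairs.
  calc _ ≤ ∑' q : Cosets N, g (cosetRow A q) := tsum_of_norm_bounded hgc.hasSum hterm
    _ ≤ ∑' x, g x :=
      hgc.tsum_le_tsum_of_inj _ (cosetRow_injective A) (fun x _ => hg0 x) (fun _ => le_rfl) hgsum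
    _ = B * (X * s + E * Y * ∑' x : Fin 2 → ℤ, ‖(x 0 : ℂ) * z + x 1‖ ^ (-((wt κ + 2) / 2))) := by
      rw [hg, tsum_mul_left, (hSsum.mul_left _).tsum_add (hlat.mul_left _), tsum_mul_left,
        tsum_mul_left]
    _ ≤ B * (X * s + E * Y * D) := by
      gcongr
      exact hD z hz
    _ ≤ _ := by
      have h1 : 0 ≤ X * (E * D) := by positivity
      have h2 : 0 ≤ Y * s := by positivity
      have : B * (s + E * D) * (X + Y) =
        B * (X * s + E * Y * D) + B * (X * (E * D) + Y * s) := by ring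
      rw [this]
      have : 0 ≤ B * (X * (E * D) + Y * s) := by positivity
      linarith

lemma isZeroAtImInfty_atCusp (κ m : ℤ) (N : ℕ) (hk : 2 < wt κ) (hm : 0 < m) (A : SL(2, ℤ)) :
    IsZeroAtImInfty (atCusp κ (poincare κ m N ((wt κ : ℂ) / 2)) A) := by
  obtain ⟨C, hC, h⟩ := exists_atCusp_bound κ m N hk A
  have hm' : (0 : ℝ) < m := by exact_mod_cast hm
  have h1 : Tendsto (fun y : ℝ => C * (Real.exp (-(2 * Real.pi * (m * y))) +
      y ^ (-((wt κ - 2) / 2)))) atTop (𝓝 (C * (0 + 0))) := by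
    refine Tendsto.const_mul _ (Tendsto.add ?_ (tendsto_rpow_neg_atTop (by linarith)))
    refine Real.tendsto_exp_neg_atTop_nhds_zero.comp ?_
    exact (tendsto_id.const_mul_atTop hm').const_mul_atTop (by positivity)
  rw [add_zero, mul_zero] at h1
  refine squeeze_zero_norm' ?_ (h1.comp tendsto_comap)
  filter_upwards [tendsto_comap.eventually (eventually_ge_atTop (1 : ℝ))] with z hz
  exact h z hz

lemma isBigO_exp_atCusp (κ m : ℤ) (N : ℕ) (hk : 2 < wt κ) (hm : m ≤ 0) (A : SL(2, ℤ)) :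
    atCusp κ (poincare κ m N ((wt κ : ℂ) / 2)) A =O[atImInfty]
      (fun z : ℍ => Real.exp (-(2 * Real.pi * m) * z.im)) := by
  obtain ⟨C, hC, h⟩ := exists_atCusp_bound κ m N hk A
  have hm' : (m : ℝ) ≤ 0 := by exact_mod_cast hm
  refine Asymptotics.IsBigO.of_bound (C * 2) ?_
  filter_upwards [tendsto_comap.eventually (eventually_ge_atTop (1 : ℝ))] with z hz
  refine (h z hz).trans ?_
  have hy := z.im_pos
  rw [Real.norm_of_nonneg (Real.exp_pos _).le, mul_assoc C]
  refine mul_le_mul_of_nonneg_left ?_ hC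
  have h1 : z.im ^ (-((wt κ - 2) / 2)) ≤ 1 :=
    Real.rpow_le_one_of_one_le_of_nonpos hz (by linarith)
  have h2 : 1 ≤ Real.exp (-(2 * Real.pi * m) * z.im) := by
    apply Real.one_le_exp
    have := mul_nonneg Real.pi_pos.le (mul_nonneg (neg_nonneg.mpr hm') hy.le)
    nlinarith
  have h3 : -(2 * Real.pi * (m * z.im)) = -(2 * Real.pi * m) * z.im := by ring
  rw [h3]
  linarith

/-! ### Invariance -/

/-- Right multiplication by `γ` on the cosets. -/
def cosetMul {N : ℕ} (γ : CongruenceSubgroup.Gamma0 N) : Cosets N ≃ Cosets N :=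
  Quotient.congr (Equiv.mulRight γ) fun a b => by
    rw [QuotientGroup.rightRel_apply, QuotientGroup.rightRel_apply]
    simp

/-- The cocycle relation turns slashing by `γ` into right translation of the cosets. The translated
representative need not be the chosen one, so independence of the representative is essential. -/
lemma slash_poincare (κ m : ℤ) (N : ℕ) (hκ : 4 ∣ κ ∨ (Odd κ ∧ 4 ∣ N)) (s : ℂ) (γ : SL(2, ℤ))
    (hγ : γ ∈ CongruenceSubgroup.Gamma0 N) (z : ℍ) :
    slash κ (poincare κ m N s) γ z = poincare κ m N s z := by
  rw [slash, poincare, poincare, ← tsum_mul_left, ← (cosetMul ⟨γ, hγ⟩).tsum_eq (poincareTerm κ m N s z)]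
  refine tsum_congr fun q => ?_
  have h : cosetMul ⟨γ, hγ⟩ q =
      Quotient.mk (QuotientGroup.rightRel (GammaInf N)) (q.out * ⟨γ, hγ⟩) := by
    conv_lhs => rw [← Quotient.out_eq q]
    rfl
  rw [h, poincareTerm_mk κ m N hκ, poincareTerm, slash, slash, Subgroup.coe_mul,
    jFactor_zpow_mul hκ q.out.2 hγ, mul_smul]
  ring

end

section

open Filter Topology

/-! ### The big cell of `Γ_∞ \ Γ₀(N)` -/

/-- The residues prime to `M`. -/
abbrev unitResidues (M : ℕ) : Finset ℕ := (Finset.range M).filter (fun v => Nat.Coprime v M)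

/-- Indices `(c, v, n)` for the bottom rows `(N c, v + N c n)` with `c > 0`. -/
abbrev BigCell (N : ℕ) : Type := Σ c : ℕ+, (unitResidues (N * (c : ℕ))) × ℤ

lemma exists_bigCell_rep (N : ℕ) (p : BigCell N) : ∃ γ : CongruenceSubgroup.Gamma0 N,
    (γ : SL(2, ℤ)) 1 0 = ((N * (p.1 : ℕ) : ℕ) : ℤ) ∧
      (γ : SL(2, ℤ)) 1 1 = ((p.2.1 : ℕ) : ℤ) + ((N * (p.1 : ℕ) : ℕ) : ℤ) * p.2.2 := by
  have hv := (Finset.mem_filter.mp p.2.1.2).2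
  have h1 : IsCoprime ((N * (p.1 : ℕ) : ℕ) : ℤ)
      (((p.2.1 : ℕ) : ℤ) + ((N * (p.1 : ℕ) : ℕ) : ℤ) * p.2.2) :=
    (Nat.isCoprime_iff_coprime.mpr hv.symm).add_mul_left_right _
  obtain ⟨g, hg0, hg1⟩ := h1.exists_SL2_row 1
  exact ⟨⟨g, mem_Gamma0_iff_dvd.mpr ⟨(p.1 : ℕ), by rw [hg0]; push_cast; ring⟩⟩, hg0, hg1⟩

/-- A representative in `Γ₀(N)` with the bottom row of the given index. -/
def bigCellRep (N : ℕ) (p : BigCell N) : CongruenceSubgroup.Gamma0 N :=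
  (exists_bigCell_rep N p).choose

lemma bigCellRep_row (N : ℕ) (p : BigCell N) :
    (bigCellRep N p : SL(2, ℤ)) 1 0 = ((N * (p.1 : ℕ) : ℕ) : ℤ) ∧
      (bigCellRep N p : SL(2, ℤ)) 1 1 =
        ((p.2.1 : ℕ) : ℤ) + ((N * (p.1 : ℕ) : ℕ) : ℤ) * p.2.2 :=
  (exists_bigCell_rep N p).choose_spec

/-- The coset of `bigCellRep`. -/
def bigCellCoset (N : ℕ) (p : BigCell N) : Cosets N :=
  Quotient.mk (QuotientGroup.rightRel (GammaInf N)) (bigCellRep N p)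

/-- The trivial coset. -/
def oneCoset (N : ℕ) : Cosets N := Quotient.mk (QuotientGroup.rightRel (GammaInf N)) 1

/-- Proportional coprime rows with positive first entries are equal; then `v` and `n` are remainder
and quotient of `d` modulo `Nc`. -/
lemma bigCellCoset_injective {N : ℕ} (hN : 0 < N) : Function.Injective (bigCellCoset N) := by
  rintro ⟨c, v, n⟩ ⟨c', v', n'⟩ h
  have h1 := (coset_eq_iff _ _).mp h
  have hp := isCoprime_row (bigCellRep N ⟨c, v, n⟩)
  have hp' := isCoprime_row (bigCellRep N ⟨c', v', n'⟩)
  rw [(bigCellRep_row N ⟨c, v, n⟩).1, (bigCellRep_row N ⟨c, v, n⟩).2] at h1 hp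
  rw [(bigCellRep_row N ⟨c', v', n'⟩).1, (bigCellRep_row N ⟨c', v', n'⟩).2] at h1 hp'
  simp only at h1 hp hp'
  have hM : 0 < N * (c : ℕ) := Nat.mul_pos hN c.pos
  have hMM : ((N * (c' : ℕ) : ℕ) : ℤ) = ((N * (c : ℕ) : ℕ) : ℤ) := by
    apply Int.dvd_antisymm (by positivity) (by positivity)
    · exact hp'.dvd_of_dvd_mul_left ⟨_, h1.symm⟩
    · exact hp.dvd_of_dvd_mul_right (Dvd.intro_left _ h1.symm)
  have hcc : c' = c := by
    have : N * (c' : ℕ) = N * (c : ℕ) := by exact_mod_cast hMM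
    exact PNat.eq (Nat.eq_of_mul_eq_mul_left hN this)
  subst hcc
  have hMz : ((N * (c' : ℕ) : ℕ) : ℤ) ≠ 0 := by exact_mod_cast hM.ne'
  have hd : ((v : ℕ) : ℤ) + ((N * (c' : ℕ) : ℕ) : ℤ) * n = ((v' : ℕ) : ℤ) + ((N * (c' : ℕ) : ℕ) : ℤ) * n' := by
    apply mul_left_cancel₀ hMz
    rw [h1, mul_comm]
  have hvlt : (v : ℕ) < N * (c' : ℕ) := Finset.mem_range.mp (Finset.mem_filter.mp v.2).1
  have hvlt' : (v' : ℕ) < N * (c' : ℕ) := Finset.mem_range.mp (Finset.mem_filter.mp v'.2).1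
  have hvv : ((v : ℕ) : ℤ) = ((v' : ℕ) : ℤ) := by
    have := congrArg (· % ((N * (c' : ℕ) : ℕ) : ℤ)) hd
    simp only [Int.add_mul_emod_self_left] at this
    rwa [Int.emod_eq_of_lt (by positivity) (by exact_mod_cast hvlt),
      Int.emod_eq_of_lt (by positivity) (by exact_mod_cast hvlt')] at this
  have hv : v = v' := Subtype.ext (by exact_mod_cast hvv)
  subst hv
  have hn : n = n' := mul_left_cancel₀ hMz (add_left_cancel hd)
  rw [hn]

lemma oneCoset_notMem_range {N : ℕ} (hN : 0 < N) (p : BigCell N) :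
    bigCellCoset N p ≠ oneCoset N := by
  intro h
  have h1 := (coset_eq_iff _ _).mp h
  rw [(bigCellRep_row N p).1] at h1
  simp [hN.ne'] at h1

lemma mem_range_bigCellCoset {N : ℕ} (hN : 0 < N) (q : Cosets N) (hq : q ≠ oneCoset N) :
    q ∈ Set.range (bigCellCoset N) := by
  induction q using Quotient.inductionOn with
  | _ γ =>
    have hc : (γ : SL(2, ℤ)) 1 0 ≠ 0 := by
      intro hc
      refine hq ((coset_eq_iff _ _).mpr ?_)
      simp [hc]
    -- Stated for any row proportional to that of `γ`, so that it covers `γ` and `-γ`, whichever has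
    -- a positive lower left entry. Division of `D` by `C` supplies `v` and `n`.
    have key : ∀ C D : ℤ, 0 < C → (N : ℤ) ∣ C → IsCoprime C D →
        D * (γ : SL(2, ℤ)) 1 0 = C * (γ : SL(2, ℤ)) 1 1 →
        Quotient.mk (QuotientGroup.rightRel (GammaInf N)) γ ∈ Set.range (bigCellCoset N) := by
      intro C D hC hdvd hcop hrow
      obtain ⟨c, rfl⟩ := hdvd
      have hc0 : 0 < c := by
        have : (0 : ℤ) < N := by exact_mod_cast hN
        exact pos_of_mul_pos_right hC this.le
      lift c to ℕ using hc0.le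
      have hc0' : 0 < c := by exact_mod_cast hc0
      have hM : (0 : ℤ) < ((N * c : ℕ) : ℤ) := by exact_mod_cast Nat.mul_pos hN hc0'
      have hCM : (N : ℤ) * (c : ℤ) = ((N * c : ℕ) : ℤ) := by push_cast; rfl
      rw [hCM] at hcop hrow
      have hv0 : 0 ≤ D % ((N * c : ℕ) : ℤ) := Int.emod_nonneg _ hM.ne'
      have hvlt : D % ((N * c : ℕ) : ℤ) < ((N * c : ℕ) : ℤ) := Int.emod_lt_of_pos _ hM
      have hv : (D % ((N * c : ℕ) : ℤ)).toNat ∈ unitResidues (N * c) := by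
        refine Finset.mem_filter.mpr ⟨Finset.mem_range.mpr (by omega), ?_⟩
        rw [← Nat.isCoprime_iff_coprime, Int.toNat_of_nonneg hv0]
        have h2 := hcop.symm.add_mul_left_left (-(D / ((N * c : ℕ) : ℤ)))
        have h3 : D + ((N * c : ℕ) : ℤ) * -(D / ((N * c : ℕ) : ℤ)) = D % ((N * c : ℕ) : ℤ) := by
          rw [Int.emod_def]; ring
        rwa [h3] at h2
      refine ⟨⟨⟨c, hc0'⟩, ⟨_, hv⟩, D / ((N * c : ℕ) : ℤ)⟩, ?_⟩
      rw [bigCellCoset, coset_eq_iff, (bigCellRep_row N _).1, (bigCellRep_row N _).2]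
      simp only [PNat.mk_coe]
      rw [Int.toNat_of_nonneg hv0, Int.emod_add_mul_ediv]
      linear_combination hrow
    have hdvd := mem_Gamma0_iff_dvd.mp γ.2
    have hcop := isCoprime_row (γ : SL(2, ℤ))
    rcases lt_or_gt_of_ne hc with h | h
    · exact key (-(γ : SL(2, ℤ)) 1 0) (-(γ : SL(2, ℤ)) 1 1) (by omega) ((dvd_neg).mpr hdvd)
        hcop.neg_neg (by ring)
    · exact key _ _ h hdvd hcop (by ring)

/-- The Poincaré series without the trivial coset is a sum over the big cell. -/
lemma hasSum_bigCell {N : ℕ} (hN : 0 < N) {f : Cosets N → ℂ} (hf : Summable f) :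
    HasSum (fun p => f (bigCellCoset N p)) (∑' q, f q - f (oneCoset N)) := by
  classical
  have h := hasSum_ite_sub_hasSum hf.hasSum (oneCoset N)
  have h0 : ∀ q ∉ Set.range (bigCellCoset N), (if q = oneCoset N then 0 else f q) = 0 := by
    intro q hq
    by_cases h1 : q = oneCoset N
    · rw [if_pos h1]
    · exact absurd (mem_range_bigCellCoset hN q h1) hq
  refine (((bigCellCoset_injective hN).hasSum_iff h0).mpr h).congr_fun fun p => ?_
  simp [oneCoset_notMem_range hN p]

lemma poincareTerm_oneCoset (κ m : ℤ) (N : ℕ) (hκ : 4 ∣ κ ∨ (Odd κ ∧ 4 ∣ N)) (hk : 0 < wt κ)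
    (z : ℍ) : poincareTerm κ m N ((wt κ : ℂ) / 2) z (oneCoset N) =
      delta κ m / Complex.Gamma (wt κ) * e ((m : ℂ) * (z : ℂ)) := by
  have hq : (quadSymbol 0 1 : ℤ) = 1 := by simp [quadSymbol]
  rw [oneCoset, poincareTerm_mk κ m N hκ, Subgroup.coe_one, slash_phi_eq κ m hk, one_smul]
  simp [multiplier, cocycle, hq, eps]

/-- Both `a` and `v̄` invert `v` modulo `M`, so they differ by a multiple of `M`. The determinant
relation supplies this congruence for the upper left entry of `γ`. -/
lemma e_div_eq_of_mul_modEq {M : ℕ} (hM : 0 < M) (m a : ℤ) {v : ℕ} (hv : Nat.Coprime v M)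
    (h : (M : ℤ) ∣ a * v - 1) :
    e ((m : ℂ) * ((a : ℂ) / (M : ℂ))) =
      e ((m : ℂ) * ((((v : ZMod M)⁻¹).val : ℕ) : ℂ) / (M : ℂ)) := by
  have : NeZero M := ⟨hM.ne'⟩
  have hMc : (M : ℂ) ≠ 0 := by exact_mod_cast hM.ne'
  have h1 : ((a : ℤ) : ZMod M) = (v : ZMod M)⁻¹ := by
    have h2 : ((a * v - 1 : ℤ) : ZMod M) = 0 := (ZMod.intCast_zmod_eq_zero_iff_dvd _ _).mpr h
    push_cast at h2
    have h3 := ZMod.coe_mul_inv_eq_one v hv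
    calc ((a : ℤ) : ZMod M) = a * ((v : ZMod M) * (v : ZMod M)⁻¹) := by rw [h3, mul_one]
      _ = (a * v) * (v : ZMod M)⁻¹ := by ring
      _ = _ := by rw [sub_eq_zero.mp h2, one_mul]
  have h4 : (M : ℤ) ∣ a - (((v : ZMod M)⁻¹).val : ℤ) := by
    rw [← ZMod.intCast_zmod_eq_zero_iff_dvd]
    push_cast
    rw [h1, ZMod.natCast_zmod_val, sub_self]
  obtain ⟨l, hl⟩ := h4
  have h5 : (a : ℂ) = ((((v : ZMod M)⁻¹).val : ℕ) : ℂ) + (M : ℂ) * (l : ℂ) := by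
    have : a = (((v : ZMod M)⁻¹).val : ℤ) + M * l := by linarith
    exact_mod_cast congrArg (Int.cast : ℤ → ℂ) this
  have h6 : (m : ℂ) * ((a : ℂ) / (M : ℂ)) =
      (m : ℂ) * ((((v : ZMod M)⁻¹).val : ℕ) : ℂ) / (M : ℂ) + ((m * l : ℤ) : ℂ) := by
    rw [h5]
    push_cast
    field_simp
  rw [h6, e_add, e_int, mul_one]

/-- The terms of the Poincaré series in terms of the bottom row. -/
lemma slash_phi_of_row (κ m : ℤ) (hk : 0 < wt κ) (z : ℍ) {M : ℕ} (hM : 0 < M)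
    (hκM : 4 ∣ κ ∨ (Odd κ ∧ (4 : ℤ) ∣ (M : ℤ))) {v : ℕ} (hv : Nat.Coprime v M) (n : ℤ)
    {γ : SL(2, ℤ)} (hr0 : γ 1 0 = (M : ℤ)) (hr1 : γ 1 1 = (v : ℤ) + (M : ℤ) * n) :
    slash κ (phi κ m ((wt κ : ℂ) / 2)) γ z =
      delta κ m / Complex.Gamma (wt κ) * (((M : ℝ) ^ (-wt κ) : ℝ) : ℂ) *
      (multiplier κ (M : ℤ) (v : ℤ) *
        e ((m : ℂ) * ((((v : ZMod M)⁻¹).val : ℕ) : ℂ) / (M : ℂ))) *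
      (((z : ℂ) + (v : ℂ) / (M : ℂ) + n) ^ (-((wt κ : ℝ) : ℂ)) *
        e (-((m : ℝ) / (M : ℝ) ^ 2 : ℝ) / ((z : ℂ) + (v : ℂ) / (M : ℂ) + n))) := by
  rw [slash_phi_eq κ m hk]
  have hdet := det_eq_one γ
  have hMr : (0 : ℝ) < (M : ℝ) := by exact_mod_cast hM
  have hMc : (M : ℂ) ≠ 0 := by exact_mod_cast hM.ne'
  set w : ℂ := (z : ℂ) + (v : ℂ) / (M : ℂ) + n with hw
  have hw0 : w ≠ 0 := by
    have : 0 < ((z : ℂ) + (v : ℂ) / (M : ℂ)).im := by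
      have h1 : ((v : ℂ) / (M : ℂ)).im = 0 := by
        rw [← Complex.ofReal_natCast, ← Complex.ofReal_natCast, ← Complex.ofReal_div,
          Complex.ofReal_im]
      rw [Complex.add_im, h1, add_zero]
      exact z.im_pos
    exact add_int_ne_zero this n
  have hcoc : cocycle γ z = ((M : ℝ) : ℂ) * w := by
    rw [cocycle, hr0, hr1, hw]
    push_cast
    field_simp
    ring
  -- With `cz + d = M w`, one has `γz = a/M - 1/(M² w)`; this is the origin of the parameter `m/M²`
  -- of the Bessel expansion.
  have hsmul : e ((m : ℂ) * ((γ • z : ℍ) : ℂ)) =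
      e ((m : ℂ) * ((((v : ZMod M)⁻¹).val : ℕ) : ℂ) / (M : ℂ)) *
        e (-((m : ℝ) / (M : ℝ) ^ 2 : ℝ) / w) := by
    rw [← e_div_eq_of_mul_modEq hM m (γ 0 0) hv, ← e_add]
    · congr 1
      rw [coe_smul_eq_sub γ (by rw [hr0]; exact_mod_cast hM.ne'), hcoc, hr0]
      push_cast
      field_simp
      ring
    · rw [hr0, hr1] at hdet
      exact ⟨γ 0 1 - γ 0 0 * n, by linear_combination hdet⟩
  rw [hsmul, hr0, hr1, multiplier_add_mul hκM (by exact_mod_cast hM)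
    (Nat.isCoprime_iff_coprime.mpr hv.symm), hcoc, ofReal_mul_cpow hMr hw0, ← Complex.ofReal_neg,
    ← Complex.ofReal_cpow hMr.le]
  ring

/-- The terms of the Poincaré series on the big cell. -/
lemma poincareTerm_bigCell (κ m : ℤ) {N : ℕ} (hN : 0 < N) (hκ : 4 ∣ κ ∨ (Odd κ ∧ 4 ∣ N))
    (hk : 0 < wt κ) (z : ℍ) (c : ℕ+) (v : unitResidues (N * (c : ℕ))) (n : ℤ) :
    poincareTerm κ m N ((wt κ : ℂ) / 2) z (bigCellCoset N ⟨c, v, n⟩) =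
      delta κ m / Complex.Gamma (wt κ) * ((((N * (c : ℕ) : ℕ) : ℝ) ^ (-wt κ) : ℝ) : ℂ) *
      (multiplier κ ((N * (c : ℕ) : ℕ) : ℤ) ((v : ℕ) : ℤ) *
        e ((m : ℂ) * (((((v : ℕ) : ZMod (N * (c : ℕ)))⁻¹).val : ℕ) : ℂ) /
          ((N * (c : ℕ) : ℕ) : ℂ))) *
      (((z : ℂ) + ((v : ℕ) : ℂ) / ((N * (c : ℕ) : ℕ) : ℂ) + n) ^ (-((wt κ : ℝ) : ℂ)) *
        e (-((m : ℝ) / ((N * (c : ℕ) : ℕ) : ℝ) ^ 2 : ℝ) /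
          ((z : ℂ) + ((v : ℕ) : ℂ) / ((N * (c : ℕ) : ℕ) : ℂ) + n))) := by
  rw [bigCellCoset, poincareTerm_mk κ m N hκ]
  exact slash_phi_of_row κ m hk z (Nat.mul_pos hN c.pos)
    (hκ.imp id (And.imp id fun h => by exact_mod_cast h.mul_right (c : ℕ)))
    (Finset.mem_filter.mp v.2).2 n (bigCellRep_row N ⟨c, v, n⟩).1 (bigCellRep_row N ⟨c, v, n⟩).2

end

section

open Filter Topology

/-! ### The Fourier expansion -/

/-- The part of the `n`-th Fourier coefficient that belongs to `c`, times `q ^ n`. -/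
def fourierTerm (κ m : ℤ) (N : ℕ) (z : ℍ) (p : ℕ+ × ℕ+) : ℂ :=
  2 * Real.pi * Complex.I ^ (-(wt κ : ℂ)) / Complex.Gamma (wt κ) *
    coeffTerm κ m N ((p.2 : ℕ) : ℤ) ((wt κ : ℂ) / 2) p.1 *
    (((((p.2 : ℕ) : ℝ) ^ (wt κ - 1) : ℝ) : ℂ) * e (((p.2 : ℕ) : ℂ) * (z : ℂ)))

lemma summable_fourierTerm (κ m : ℤ) {N : ℕ} (hN : 0 < N) (hk : 2 < wt κ) (z : ℍ) :
    Summable (fourierTerm κ m N z) := by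
  set B : ℝ := ‖2 * Real.pi * Complex.I ^ (-(wt κ : ℂ)) / Complex.Gamma (wt κ)‖ with hB
  have h1 := (summable_mul_rpow hN hk).mul_left
    (B * (‖delta κ m‖ * (2 * Real.pi) ^ (wt κ - 1)))
  have h2 := summable_rpow_mul_besselSeries_mul_exp (k := wt κ) (by linarith)
    (abs_nonneg (m : ℝ)) z.im_pos
  have hb : ∀ n : ℕ+, 0 ≤ besselSeries (wt κ) (4 * Real.pi ^ 2 * |(m : ℝ)| * (n : ℕ)) := fun n =>
    (abs_nonneg _).trans (abs_besselSeries_le (by linarith) (abs_of_nonneg (by positivity)).le)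
  have h := h1.mul_of_nonneg h2 (fun c => by positivity)
    (fun n => by have := hb n; positivity)
  refine Summable.of_norm_bounded h fun p => ?_
  rw [fourierTerm, norm_mul, norm_mul, norm_nat_rpow_mul_e, coe_im, ← hB]
  have h3 := norm_coeffTerm_le κ m hN p.2 hk p.1
  have h4 := hb p.2
  calc _ ≤ B * (‖delta κ m‖ * (2 * Real.pi) ^ (wt κ - 1) *
        ((N * (p.1 : ℕ) : ℕ) : ℝ) ^ (1 - wt κ) *
        besselSeries (wt κ) (4 * Real.pi ^ 2 * |(m : ℝ)| * (p.2 : ℕ))) *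
        (((p.2 : ℕ) : ℝ) ^ (wt κ - 1) *
          Real.exp (-(2 * Real.pi * (((p.2 : ℕ) : ℝ) * z.im)))) := by gcongr
    _ = _ := by ring

lemma im_add_natCast_div (z : ℍ) (v M : ℕ) : 0 < ((z : ℂ) + (v : ℂ) / (M : ℂ)).im := by
  have h1 : ((v : ℂ) / (M : ℂ)).im = 0 := by
    rw [← Complex.ofReal_natCast, ← Complex.ofReal_natCast, ← Complex.ofReal_div,
      Complex.ofReal_im]
  rw [Complex.add_im, h1, add_zero]
  exact z.im_pos

/-- The factor of the big cell terms which does not depend on `n`. -/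
def bigCellFactor (κ m : ℤ) (M v : ℕ) : ℂ :=
  delta κ m / Complex.Gamma (wt κ) * (((M : ℝ) ^ (-wt κ) : ℝ) : ℂ) *
    (multiplier κ (M : ℤ) (v : ℤ) * e ((m : ℂ) * ((((v : ZMod M)⁻¹).val : ℕ) : ℂ) / (M : ℂ)))

/-- The sum of the big cell terms over `n`, without `bigCellFactor`. -/
def translateSum (κ m : ℤ) (z : ℍ) (M v : ℕ) : ℂ :=
  ∑' n : ℤ, ((z : ℂ) + (v : ℂ) / (M : ℂ) + n) ^ (-((wt κ : ℝ) : ℂ)) *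
    e (-((m : ℝ) / (M : ℝ) ^ 2 : ℝ) / ((z : ℂ) + (v : ℂ) / (M : ℂ) + n))

/-- Absolute convergence allows the big cell to be summed over `n`, then over the finitely many `v`,
then over `c`. -/
lemma hasSum_translateSum (κ m : ℤ) {N : ℕ} (hN : 0 < N) (hκ : 4 ∣ κ ∨ (Odd κ ∧ 4 ∣ N))
    (hk : 2 < wt κ) (z : ℍ) :
    HasSum (fun c : ℕ+ => ∑ v ∈ unitResidues (N * (c : ℕ)),
        bigCellFactor κ m (N * (c : ℕ)) v * translateSum κ m z (N * (c : ℕ)) v)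
      (poincare κ m N ((wt κ : ℂ) / 2) z -
        delta κ m / Complex.Gamma (wt κ) * e ((m : ℂ) * (z : ℂ))) := by
  have h := hasSum_bigCell hN (summable_poincareTerm κ m N hk z)
  rw [poincareTerm_oneCoset κ m N hκ (by linarith)] at h
  refine h.sigma fun c => ?_
  have hs : Summable (fun p : unitResidues (N * (c : ℕ)) × ℤ =>
      poincareTerm κ m N ((wt κ : ℂ) / 2) z (bigCellCoset N ⟨c, p⟩)) :=
    h.summable.comp_injective sigma_mk_injective
  have hv : ∀ v : unitResidues (N * (c : ℕ)), HasSum (fun n : ℤ =>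
      poincareTerm κ m N ((wt κ : ℂ) / 2) z (bigCellCoset N ⟨c, v, n⟩))
      (bigCellFactor κ m (N * (c : ℕ)) v * translateSum κ m z (N * (c : ℕ)) v) := by
    intro v
    have h1 := (hs.prod_factor v).hasSum
    simp_rw [poincareTerm_bigCell κ m hN hκ (by linarith : 0 < wt κ) z c v, tsum_mul_left] at h1 ⊢
    exact h1
  have h2 := hs.hasSum.prod_fiberwise hv
  rw [← Finset.sum_coe_sort, ← h2.unique (hasSum_fintype _)]
  exact hs.hasSum

/-- Apply the Bessel expansion at `w = z + v/M` with `t = m/M²`. The phases `e(nv/M)` combine with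
the multiplier and `e(m v̄/M)` into the Kloosterman sum. -/
lemma hasSum_fourierTerm (κ m : ℤ) {N : ℕ} (hN : 0 < N) (hk : 2 < wt κ) (z : ℍ) (c : ℕ+) :
    HasSum (fun n : ℕ+ => fourierTerm κ m N z (c, n))
      (∑ v ∈ unitResidues (N * (c : ℕ)),
        bigCellFactor κ m (N * (c : ℕ)) v * translateSum κ m z (N * (c : ℕ)) v) := by
  have hM : 0 < N * (c : ℕ) := Nat.mul_pos hN c.pos
  set M := N * (c : ℕ) with hMdef
  have h := hasSum_sum fun v (_ : v ∈ unitResidues M) =>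
    (hasSum_besselSeries_mul_e (k := wt κ) (by linarith) ((m : ℝ) / (M : ℝ) ^ 2)
      (im_add_natCast_div z v M)).mul_left (bigCellFactor κ m M v)
  refine h.congr_fun fun n => ?_
  -- One factor `2π` is the prefactor of the coefficient; the remaining `(2π)^(k-1)` belongs to the
  -- kernel.
  have h2pi : (((2 * Real.pi) ^ wt κ : ℝ) : ℂ) =
      2 * Real.pi * (((2 * Real.pi) ^ (wt κ - 1) : ℝ) : ℂ) := by
    have : (2 * Real.pi) ^ wt κ = 2 * Real.pi * (2 * Real.pi) ^ (wt κ - 1) := by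
      rw [← Real.rpow_one_add' (by positivity) (by linarith)]
      congr 1
      ring
    rw [this]
    push_cast
    rfl
  simp only [fourierTerm, coeffTerm]
  rw [← hMdef, div_mul_eq_mul_div (kloosterman _ _ _ _), mul_div_assoc (kloosterman _ _ _ _),
    coeffKernel_div κ m n hM (by linarith), kloosterman_eq, Finset.sum_mul, Finset.mul_sum,
    Finset.sum_mul]
  refine Finset.sum_congr rfl fun v _ => ?_
  have he : e (((m : ℂ) * ((((v : ZMod M)⁻¹).val : ℕ) : ℂ) + (((n : ℕ) : ℤ) : ℂ) * (v : ℂ)) /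
      (M : ℂ)) * e (((n : ℕ) : ℂ) * (z : ℂ)) =
      e ((m : ℂ) * ((((v : ZMod M)⁻¹).val : ℕ) : ℂ) / (M : ℂ)) *
        e (((n : ℕ) : ℂ) * ((z : ℂ) + (v : ℂ) / (M : ℂ))) := by
    rw [← e_add, ← e_add]
    congr 1
    push_cast
    ring
  rw [bigCellFactor, lipschitzConst, h2pi, Complex.ofReal_mul _ ((M : ℝ) ^ (-wt κ))]
  linear_combination (2 * Real.pi * Complex.I ^ (-(wt κ : ℂ)) / Complex.Gamma (wt κ) *
    multiplier κ (M : ℤ) (v : ℤ) * delta κ m * (((2 * Real.pi) ^ (wt κ - 1) : ℝ) : ℂ) *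
    (((M : ℝ) ^ (-wt κ) : ℝ) : ℂ) *
    (besselSeries (wt κ) (-(4 * Real.pi ^ 2 * ((m : ℝ) / (M : ℝ) ^ 2) * (n : ℕ))) : ℂ) *
    ((((n : ℕ) : ℝ) ^ (wt κ - 1) : ℝ) : ℂ)) * he

lemma hasSum_fourierExpansion (κ m : ℤ) {N : ℕ} (hN : 0 < N) (hκ : 4 ∣ κ ∨ (Odd κ ∧ 4 ∣ N))
    (hk : 2 < wt κ) (z : ℍ) :
    HasSum (fun n : ℕ+ => coeff κ m N ((n : ℕ) : ℤ) ((wt κ : ℂ) / 2) / Complex.Gamma (wt κ) *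
        ((((n : ℕ) : ℝ) ^ (wt κ - 1) : ℝ) : ℂ) * e (((n : ℕ) : ℂ) * (z : ℂ)))
      (poincare κ m N ((wt κ : ℂ) / 2) z -
        delta κ m / Complex.Gamma (wt κ) * e ((m : ℂ) * (z : ℂ))) := by
  have hs := summable_fourierTerm κ m hN hk z
  have h1 := (hs.hasSum.prod_fiberwise fun c => hasSum_fourierTerm κ m hN hk z c).unique
    (hasSum_translateSum κ m hN hκ hk z)
  rw [← h1]
  -- Interchange of `c` and `n`, by absolute convergence of the double series.
  refine ((Equiv.prodComm ℕ+ ℕ+).hasSum_iff.mpr hs.hasSum).prod_fiberwise fun n => ?_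
  have h2 := (((summable_coeffTerm κ m hN n hk).hasSum).mul_left
    (2 * Real.pi * Complex.I ^ (-(wt κ : ℂ)) / Complex.Gamma (wt κ))).mul_right
    (((((n : ℕ) : ℝ) ^ (wt κ - 1) : ℝ) : ℂ) * e (((n : ℕ) : ℂ) * (z : ℂ)))
  refine (congrArg (HasSum _) ?_).mp h2
  rw [coeff]
  ring

/-! ### Holomorphy -/

lemma differentiable_e_mul (a : ℂ) : Differentiable ℂ (fun w => e (a * w)) := by
  unfold e
  fun_prop

/-- A function with a Fourier expansion is holomorphic. -/
lemma mdiff_of_hasSum {f : ℍ → ℂ} {b : ℂ} {m : ℤ} {a : ℕ+ → ℂ}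
    (h : ∀ z : ℍ, HasSum (fun n : ℕ+ => a n * e (((n : ℕ) : ℂ) * (z : ℂ)))
      (f z - b * e ((m : ℂ) * (z : ℂ)))) : MDiff f := by
  rw [mdifferentiable_iff]
  intro w₀ hw₀
  have hw₀ : 0 < w₀.im := hw₀
  set U : Set ℂ := {w | w₀.im / 2 < w.im} with hU
  have hUo : IsOpen U := isOpen_lt continuous_const Complex.continuous_im
  -- At half the height of `w₀` the series converges absolutely, and its norms dominate the terms on
  -- the whole half-plane above.
  set z₁ : ℍ := ⟨(w₀.im / 2 : ℝ) * Complex.I, by simpa using hw₀⟩ with hz₁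
  have hd : DifferentiableOn ℂ (fun w => ∑' n : ℕ+, a n * e (((n : ℕ) : ℂ) * w)) U := by
    refine Complex.differentiableOn_tsum_of_summable_norm (h z₁).summable.norm
      (fun n => ((differentiable_e_mul _).const_mul _).differentiableOn) hUo fun n w hw => ?_
    have hw : w₀.im / 2 < w.im := hw
    have h1 : (((n : ℕ) : ℂ) * w).im = ((n : ℕ) : ℝ) * w.im := by simp
    have h2 : (((n : ℕ) : ℂ) * (z₁ : ℂ)).im = ((n : ℕ) : ℝ) * (w₀.im / 2) := by simp [hz₁]
    rw [norm_mul, norm_mul, norm_e, norm_e, h1, h2]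
    gcongr
  have hd' := hd.add ((differentiable_e_mul (m : ℂ)).const_mul b).differentiableOn
  refine ((hd'.congr fun w hw => ?_).differentiableAt (hUo.mem_nhds ?_)).differentiableWithinAt
  · have hw : w₀.im / 2 < w.im := hw
    have hw0 : 0 < w.im := by linarith
    have := (h ⟨w, hw0⟩).tsum_eq
    simp only [Function.comp_apply, ofComplex_apply_of_im_pos hw0, Pi.add_apply]
    rw [this]
    simp
  · change w₀.im / 2 < w₀.im
    linarith

lemma mdiff_poincare (κ m : ℤ) {N : ℕ} (hN : 0 < N) (hκ : 4 ∣ κ ∨ (Odd κ ∧ 4 ∣ N))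
    (hk : 2 < wt κ) : MDiff (poincare κ m N ((wt κ : ℂ) / 2)) :=
  mdiff_of_hasSum (hasSum_fourierExpansion κ m hN hκ hk)

end

end MaassPoincare

end

/-! ### The theorem -/

open MaassPoincare in
theorem corollary3p3 (κ m : ℤ) (N : ℕ) (hN : 0 < N) (hk : 2 < wt κ)
    (hκ : 4 ∣ κ ∨ (Odd κ ∧ 4 ∣ N)) :
    (∀ z : UpperHalfPlane, Summable (poincareTerm κ m N ((wt κ : ℂ) / 2) z)) ∧
    (∀ n : ℕ+, Summable (coeffTerm κ m N ((n : ℕ) : ℤ) ((wt κ : ℂ) / 2))) ∧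
    (∀ z : UpperHalfPlane, HasSum
      (fun n : ℕ+ => coeff κ m N ((n : ℕ) : ℤ) ((wt κ : ℂ) / 2) / Complex.Gamma (wt κ) *
        ((((n : ℕ) : ℝ) ^ (wt κ - 1) : ℝ) : ℂ) * e (((n : ℕ) : ℂ) * (z : ℂ)))
      (poincare κ m N ((wt κ : ℂ) / 2) z -
        delta κ m / Complex.Gamma (wt κ) * e ((m : ℂ) * (z : ℂ)))) ∧
    (0 < m → IsCuspidalForm κ N (poincare κ m N ((wt κ : ℂ) / 2))) ∧
    (m < 0 → IsWeaklyHolomorphicForm κ N (poincare κ m N ((wt κ : ℂ) / 2))) ∧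
    (m = 0 → IsHolomorphicForm κ N (poincare κ m N ((wt κ : ℂ) / 2))) := by
  refine ⟨summable_poincareTerm κ m N hk, fun n => summable_coeffTerm κ m hN n hk,
    hasSum_fourierExpansion κ m hN hκ hk, fun hm => ?_, fun hm => ?_, fun hm => ?_⟩
  · exact ⟨mdiff_poincare κ m hN hκ hk, slash_poincare κ m N hκ _,
      isZeroAtImInfty_atCusp κ m N hk hm⟩
  · exact ⟨mdiff_poincare κ m hN hκ hk, slash_poincare κ m N hκ _,
      fun A => ⟨_, isBigO_exp_atCusp κ m N hk hm.le A⟩⟩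
  · refine ⟨mdiff_poincare κ m hN hκ hk, slash_poincare κ m N hκ _, fun A => ?_⟩
    have h := isBigO_exp_atCusp κ m N hk hm.le A
    -- At `m = 0` the exponential majorant is the constant `1`, so the growth bound is boundedness.
    subst hm
    refine h.congr_right fun z => ?_
    simp
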